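/- **Conventions.** A functor is a *reflector* if it is the left adjoint of an adjunction whose counit is invertible. For a bicategory $\mathcal K$, pseudofunctors $F:\mathcal J\to\mathcal K$, $W:\mathcal J\to\mathrm{Cat}$ and $A\in\mathcal K$, let $\mathrm{Psd}[\mathcal J,\mathrm{Cat}](W,\mathcal K(A,F-))$ be the category of pseudonatural transformations $W\Rightarrow\mathcal K(A,F-)$ and modifications. A pseudonatural transformation $\lambda:W\Rightarrow\mathcal K(L,F-)$ induces, for every $A$, the comparison functor $$\kappa_A:\mathcal K(A,L)\to\mathrm{Psd}[\mathcal J,\mathrm{Cat}](W,\mathcal K(A,F-)),\qquad \theta\mapsto\mathcal K(\theta,F-)\circ\lambda .$$ The pair $(L,\lambda)$ is a *bilimit* of $F$ weighted by $W$ if every $\kappa_A$ is an equivalence, and a *reflector-limit* of $F$ weighted by $W$ if every $\kappa_A$ is a reflector. A 2-category admits weighted $\mathcal J$-indexed bilimits (reflector-limits), for a 2-category $\mathcal J$, if these exist for all 2-functors $F:\mathcal J\to\mathcal K$ and $W:\mathcal J\to\mathrm{Cat}$. A lax-idempotent pseudomonad $D$ on a 2-category $\mathcal K$ is taken in the equivalent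 form of a left Kan pseudomonad: objects $DA$ and 1-cells $y_A:A\to DA$ for all $A\in\mathcal K$, and for every $f:A\to DB$ a left Kan extension $f^{\mathbb D}:DA\to DB$ of $f$ along $y_A$ with invertible 2-cell $f\Rightarrow f^{\mathbb D}y_A$, such that the identity 2-cell exhibits $1_{DA}$ as a left Kan extension of $y_A$ along $y_A$, and $g^{\mathbb D}$ preserves the left Kan extension $f^{\mathbb D}$ for all $f:A\to DB$, $g:B\to DC$. The Kleisli 2-category $\mathcal K_D$ has as objects the $DA$, $A\in\mathcal K$, as 1-cells $DA\to DB$ those 1-cells of $\mathcal K$ that preserve the left Kan extensions $f^{\mathbb D}$ for all $f:X\to DA$, and as 2-cells all 2-cells of $\mathcal K$ between these. **Theorem.** Let $\mathcal J$ be a 2-category, $\mathcal K$ a 2-category that admits weighted $\mathcal J$-indexed bilimits, and $D$ a lax-idempotent pseudomonad on $\mathcal K$. Then the Kleisli 2-category $\mathcal K_D$ admits weighted $\mathcal J$-indexed reflector-limits. Moreover, let $\mathrm{PROF}$ be the bicategory of locally small categories, small profunctors $H:\mathcal B^{op}\times\mathcal A\to\mathrm{Set}$ from $\mathcal A$ to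 $\mathcal B$ (that is, every presheaf $H(-,a)$ is a small colimit of representables), composed by coends, and natural transformations. Then $\mathrm{PROF}$ is reflector-complete: for every small bicategory $\mathcal J$ and all pseudofunctors $F:\mathcal J\to\mathrm{PROF}$ and $W:\mathcal J\to\mathrm{Cat}$ with values in small categories, a reflector-limit of $F$ weighted by $W$ exists. -/

import Mathlib

open CategoryTheory Bicategory

attribute [-instance] CategoryTheory.catToReflQuiver

namespace ReflLimit

universe w₁ v₁ u₁ w₂ v₂ u₂ v₃ u₃ u

/-! ### Reflectors in `Cat` -/

/-- A functor `F` is a reflector if it is a left adjoint in an adjunction whose counit is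
invertible. -/
def IsReflector {C : Type u₁} [Category.{v₁} C] {E : Type u₂} [Category.{v₂} E]
    (F : C ⥤ E) : Prop :=
  ∃ (G : E ⥤ C) (adj : F ⊣ G), IsIso adj.counit

/-! ### Weighted cones -/

section Cones

variable {J : Type u₂} [Bicategory.{w₂, v₂} J] {K : Type u₁} [Bicategory.{w₁, v₁} K]

/-- A `W`-weighted cone over `F` with vertex `A`, that is, a pseudonatural transformation
`W ⇒ K(A, F -)` with components `app j : W j ⥤ K(A, F j)`. Spelled out in components so that
the categories `W j` and `K(A, F j)` may live in different universes. -/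
structure WCone (W : J ⥤ᵖ Cat.{v₃, u₃}) (F : J ⥤ᵖ K) (A : K) where
  /-- The component at an object. -/
  app (j : J) : W.obj j ⥤ (A ⟶ F.obj j)
  /-- The component at `x` of the invertible 2-cell of functors at a 1-cell `f`. -/
  nat {i j : J} (f : i ⟶ j) (x : W.obj i) :
    (app j).obj ((W.map f).toFunctor.obj x) ≅ (app i).obj x ≫ F.map f
  /-- Naturality of `nat f`. -/
  nat_naturality {i j : J} (f : i ⟶ j) {x y : W.obj i} (p : x ⟶ y) :
    (app j).map ((W.map f).toFunctor.map p) ≫ (nat f y).hom =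
      (nat f x).hom ≫ (app i).map p ▷ F.map f
  /-- Compatibility with 2-cells. -/
  nat_map₂ {i j : J} {f g : i ⟶ j} (η : f ⟶ g) (x : W.obj i) :
    (app j).map ((W.map₂ η).toNatTrans.app x) ≫ (nat g x).hom =
      (nat f x).hom ≫ (app i).obj x ◁ F.map₂ η
  /-- Compatibility with identities. -/
  nat_id (j : J) (x : W.obj j) :
    (nat (𝟙 j) x).hom ≫ (app j).obj x ◁ (F.mapId j).hom =
      (app j).map ((W.mapId j).hom.toNatTrans.app x) ≫ (ρ_ ((app j).obj x)).inv
  /-- Compatibility with composition. -/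
  nat_comp {i j k : J} (f : i ⟶ j) (g : j ⟶ k) (x : W.obj i) :
    (nat (f ≫ g) x).hom ≫ (app i).obj x ◁ (F.mapComp f g).hom =
      (app k).map ((W.mapComp f g).hom.toNatTrans.app x) ≫
        (nat g ((W.map f).toFunctor.obj x)).hom ≫
          (nat f x).hom ▷ F.map g ≫ (α_ ((app i).obj x) (F.map f) (F.map g)).hom

namespace WCone

variable {W : J ⥤ᵖ Cat.{v₃, u₃}} {F : J ⥤ᵖ K}

/-- A morphism of weighted cones with the same vertex is a modification. -/
@[ext]
structure Hom {A : K} (c d : WCone W F A) where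
  /-- The component at an object. -/
  app (j : J) : c.app j ⟶ d.app j
  /-- The modification axiom. -/
  comm {i j : J} (f : i ⟶ j) (x : W.obj i) :
    (app j).app ((W.map f).toFunctor.obj x) ≫ (d.nat f x).hom =
      (c.nat f x).hom ≫ (app i).app x ▷ F.map f

/-- The category of `W`-weighted cones over `F` with vertex `A`. -/
instance {A : K} : Category (WCone W F A) where
  Hom c d := Hom c d
  id c := { app := fun j => 𝟙 (c.app j), comm := by intros; simp }
  comp s t :=
    { app := fun j => s.app j ≫ t.app j
      comm := fun {i j} f x => by
        have h₁ := s.comm f x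
        have h₂ := t.comm f x
        simp only [NatTrans.comp_app, Category.assoc, comp_whiskerRight]
        rw [h₂, reassoc_of% h₁] }

@[ext]
theorem hom_ext {A : K} {c d : WCone W F A} {s t : c ⟶ d} (h : ∀ j, s.app j = t.app j) :
    s = t :=
  Hom.ext (funext h)

@[simp]
theorem id_app {A : K} (c : WCone W F A) (j : J) : Hom.app (𝟙 c) j = 𝟙 (c.app j) := rfl

@[simp]
theorem comp_app {A : K} {c d e : WCone W F A} (s : c ⟶ d) (t : d ⟶ e) (j : J) :
    (s ≫ t).app j = s.app j ≫ t.app j := rfl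

/-- The cone `K(θ, F -) ∘ c` with vertex `A`, for a cone `c` with vertex `L` and `θ : A ⟶ L`. -/
@[reducible]
def restrict {L : K} (c : WCone W F L) {A : K} (θ : A ⟶ L) : WCone W F A where
  app j :=
    { obj := fun x => θ ≫ (c.app j).obj x
      map := fun p => θ ◁ (c.app j).map p }
  nat {i j} f x := whiskerLeftIso θ (c.nat f x) ≪≫ (α_ θ ((c.app i).obj x) (F.map f)).symm
  nat_naturality {i j} f x y p := by
    have h := c.nat_naturality f p
    simp only [Iso.trans_hom, whiskerLeftIso_hom, Iso.symm_hom, Category.assoc]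
    rw [← Bicategory.whiskerLeft_comp_assoc, h]
    simp
  nat_map₂ {i j f g} η x := by
    have h := c.nat_map₂ η x
    simp only [Iso.trans_hom, whiskerLeftIso_hom, Iso.symm_hom, Category.assoc]
    rw [← Bicategory.whiskerLeft_comp_assoc, h]
    simp
  nat_id j x := by
    have h := c.nat_id j x
    simp only [Iso.trans_hom, whiskerLeftIso_hom, Iso.symm_hom, Category.assoc]
    rw [← associator_inv_naturality_right, ← Bicategory.whiskerLeft_comp_assoc, h]
    simp
  nat_comp {i j k} f g x := by
    have h := c.nat_comp f g x
    simp only [Iso.trans_hom, whiskerLeftIso_hom, Iso.symm_hom, Category.assoc]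
    rw [← associator_inv_naturality_right, ← Bicategory.whiskerLeft_comp_assoc, h]
    simp

/-- The canonical comparison functor `K(A, L) ⥤ Psd[J, Cat](W, K(A, F -))`,
`θ ↦ K(θ, F -) ∘ c`. -/
def comparison {L : K} (c : WCone W F L) (A : K) : (A ⟶ L) ⥤ WCone W F A where
  obj θ := c.restrict θ
  map {θ θ'} τ :=
    { app := fun j =>
        { app := fun x => τ ▷ (c.app j).obj x
          naturality := fun x y p => whisker_exchange τ ((c.app j).map p) }
      comm := by
        intro i j f x
        simp [← whisker_exchange_assoc] }

end WCone

/-- `L` with `c` is a bilimit of `F` weighted by `W`. -/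
def WCone.IsBilimit {W : J ⥤ᵖ Cat.{v₃, u₃}} {F : J ⥤ᵖ K} {L : K} (c : WCone W F L) : Prop :=
  ∀ A : K, (c.comparison A).IsEquivalence

/-- `L` with `c` is a reflector-limit of `F` weighted by `W`. -/
def WCone.IsReflectorLimit {W : J ⥤ᵖ Cat.{v₃, u₃}} {F : J ⥤ᵖ K} {L : K} (c : WCone W F L) :
    Prop :=
  ∀ A : K, IsReflector (c.comparison A)

end Cones

/-- The 2-category `K` admits all bilimits of 2-functors `J → K` weighted by 2-functors
`J → Cat`. -/
def HasWeightedBilimits (J : Type u₂) [Bicategory.{w₂, v₂} J] (K : Type u₁)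
    [Bicategory.{w₁, v₁} K] : Prop :=
  ∀ (F : StrictPseudofunctor J K) (W : StrictPseudofunctor J Cat.{v₃, u₃}),
    ∃ (L : K) (c : WCone W.toPseudofunctor F.toPseudofunctor L), c.IsBilimit

/-- The 2-category `K` admits all reflector-limits of 2-functors `J → K` weighted by 2-functors
`J → Cat`. -/
def HasWeightedReflectorLimits (J : Type u₂) [Bicategory.{w₂, v₂} J] (K : Type u₁)
    [Bicategory.{w₁, v₁} K] : Prop :=
  ∀ (F : StrictPseudofunctor J K) (W : StrictPseudofunctor J Cat.{v₃, u₃}),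
    ∃ (L : K) (c : WCone W.toPseudofunctor F.toPseudofunctor L), c.IsReflectorLimit

/-! ### Left Kan pseudomonads and the Kleisli 2-category -/

/-- A left Kan pseudomonad on `K`. -/
structure LeftKanPseudomonad (K : Type u₁) [Bicategory.{w₁, v₁} K] where
  /-- The action on objects. -/
  obj : K → K
  /-- The unit `y`. -/
  y (A : K) : A ⟶ obj A
  /-- The chosen extension of `f` along `y`, with its 2-cell `f ⟶ y A ≫ f^D`. -/
  ext {A B : K} (f : A ⟶ obj B) : LeftExtension (y A) f
  /-- The chosen extension is a left Kan extension. -/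
  ext_isKan {A B : K} (f : A ⟶ obj B) : Nonempty (ext f).IsKan
  /-- The 2-cell of the chosen extension is invertible. -/
  ext_isIso {A B : K} (f : A ⟶ obj B) : IsIso (ext f).unit
  /-- The identity of `D A` is the left Kan extension of `y A` along itself, via the identity. -/
  id_isKan (A : K) : Nonempty (LeftExtension.mk (𝟙 (obj A)) (ρ_ (y A)).inv).IsKan
  /-- `g^D` preserves the chosen left Kan extensions. -/
  ext_preserves {A B C : K} (g : B ⟶ obj C) (f : A ⟶ obj B) :
    Nonempty ((ext f).whisker (ext g).extension).IsKan

section Kleisli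

variable {K : Type u₁} [Bicategory.{w₁, v₁} K]

/-- A 1-cell `h` between free algebras is a pseudomorphism if it preserves the chosen left Kan
extensions of the source algebra. -/
def LeftKanPseudomonad.IsPseudomorphism (D : LeftKanPseudomonad K) {A B : K}
    (h : D.obj A ⟶ D.obj B) : Prop :=
  ∀ ⦃X : K⦄ (f : X ⟶ D.obj A), Nonempty ((D.ext f).whisker h).IsKan

theorem isKan_iff {a b c : K} {f : a ⟶ b} {g : a ⟶ c} (t : LeftExtension f g) :
    Nonempty t.IsKan ↔
      ∀ (k : b ⟶ c) (σ : g ⟶ f ≫ k), ∃! τ : t.extension ⟶ k, t.unit ≫ f ◁ τ = σ := by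
  constructor
  · rintro ⟨H⟩ k σ
    exact ⟨H.desc (.mk k σ), H.fac (.mk k σ), fun τ hτ =>
      H.hom_ext (hτ.trans (H.fac (.mk k σ)).symm)⟩
  · intro H
    choose d hd hu using H
    exact ⟨.mk (fun s => LeftExtension.homMk (d s.extension s.unit) (hd s.extension s.unit))
      (fun s τ => StructuredArrow.hom_ext _ _ (hu _ _ _ (LeftExtension.w τ)))⟩

theorem isKan_assoc {a b c d e : K} {f : a ⟶ b} {g : a ⟶ c} (t : LeftExtension f g)
    (h : c ⟶ d) (k : d ⟶ e) (H : Nonempty ((t.whisker h).whisker k).IsKan) :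
    Nonempty (t.whisker (h ≫ k)).IsKan := by
  rw [isKan_iff] at H ⊢
  intro l σ
  obtain ⟨τ, hτ, hu⟩ : ∃! τ : (t.extension ≫ h) ≫ k ⟶ l,
      ((t.unit ▷ h ≫ (α_ f t.extension h).hom) ▷ k ≫ (α_ f (t.extension ≫ h) k).hom) ≫ f ◁ τ =
        (α_ g h k).hom ≫ σ := H l ((α_ g h k).hom ≫ σ)
  simp only [LeftExtension.whisker_extension, LeftExtension.whisker_unit]
  refine ⟨(α_ t.extension h k).inv ≫ τ, ?_, fun τ' h' => ?_⟩
  · beta_reduce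
    rw [← cancel_epi (α_ g h k).hom, ← hτ]
    simp
  · rw [Iso.eq_inv_comp]
    apply hu
    rw [← h']
    simp

theorem LeftKanPseudomonad.IsPseudomorphism.id (D : LeftKanPseudomonad K) (A : K) :
    D.IsPseudomorphism (𝟙 (D.obj A)) := by
  intro X f
  have H := D.ext_isKan f
  rw [isKan_iff] at H ⊢
  intro l σ
  obtain ⟨τ, hτ, hu⟩ := H l ((ρ_ f).inv ≫ σ)
  simp only [LeftExtension.whisker_extension, LeftExtension.whisker_unit]
  refine ⟨(ρ_ (D.ext f).extension).hom ≫ τ, ?_, fun τ' h' => ?_⟩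
  · beta_reduce
    rw [← cancel_epi (ρ_ f).inv, ← hτ]
    simp
  · rw [← Iso.inv_comp_eq]
    apply hu
    rw [← h']
    simp

theorem LeftKanPseudomonad.IsPseudomorphism.comp (D : LeftKanPseudomonad K) {A B C : K}
    {h : D.obj A ⟶ D.obj B} {k : D.obj B ⟶ D.obj C} (hh : D.IsPseudomorphism h)
    (hk : D.IsPseudomorphism k) : D.IsPseudomorphism (h ≫ k) := by
  intro X f
  obtain ⟨H⟩ := hh f
  obtain ⟨H'⟩ := D.ext_isKan (f ≫ h)
  obtain ⟨H''⟩ := hk (f ≫ h)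
  exact isKan_assoc _ _ _
    ⟨LeftExtension.IsKan.whiskerOfCommute _ _ (H'.uniqueUpToIso H) k H''⟩

/-- The Kleisli 2-category of `D`: its objects are the free algebras `D A`, indexed by the objects
`A` of `K`, its 1-cells are the pseudomorphisms `D A ⟶ D B`, its 2-cells are those of `K`. -/
structure Kleisli (D : LeftKanPseudomonad K) where
  /-- The object of `K` on which the algebra is free. -/
  base : K

namespace Kleisli

variable {D : LeftKanPseudomonad K}

/-- 1-cells of the Kleisli 2-category. -/
@[ext]
structure Hom (A B : Kleisli D) where
  /-- The underlying 1-cell of `K`. -/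
  hom : D.obj A.base ⟶ D.obj B.base
  /-- It is a pseudomorphism. -/
  isPseudomorphism : D.IsPseudomorphism hom

@[simps id_hom comp_hom]
instance categoryStruct : CategoryStruct (Kleisli D) where
  Hom A B := Hom A B
  id A := ⟨𝟙 (D.obj A.base), .id D A.base⟩
  comp h k := ⟨h.hom ≫ k.hom, .comp D h.isPseudomorphism k.isPseudomorphism⟩

theorem hom_ext {A B : Kleisli D} {h k : A ⟶ B} (e : h.hom = k.hom) : h = k :=
  Hom.ext e

/-- 2-cells of the Kleisli 2-category. -/
@[ext]
structure Hom₂ {A B : Kleisli D} (h k : A ⟶ B) where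
  /-- The underlying 2-cell of `K`. -/
  hom : h.hom ⟶ k.hom

@[simps!]
instance homCategory (A B : Kleisli D) : Category (A ⟶ B) where
  Hom h k := Hom₂ h k
  id h := ⟨𝟙 h.hom⟩
  comp s t := ⟨s.hom ≫ t.hom⟩

@[ext]
theorem hom₂_ext {A B : Kleisli D} {h k : A ⟶ B} {s t : h ⟶ k} (e : s.hom = t.hom) : s = t :=
  Hom₂.ext e

/-- An invertible 2-cell of the Kleisli 2-category from one of `K`. -/
@[simps]
def isoMk {A B : Kleisli D} {h k : A ⟶ B} (e : h.hom ≅ k.hom) : h ≅ k where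
  hom := ⟨e.hom⟩
  inv := ⟨e.inv⟩

@[simps!]
instance bicategory : Bicategory (Kleisli D) where
  whiskerLeft {_ _ _} h k l s := (Hom₂.mk (h.hom ◁ Hom₂.hom s) : Hom₂ (h ≫ k) (h ≫ l))
  whiskerRight {_ _ _} k l s h := (Hom₂.mk (Hom₂.hom s ▷ h.hom) : Hom₂ (k ≫ h) (l ≫ h))
  associator h k l :=
    (isoMk (α_ h.hom k.hom l.hom) : (h ≫ k) ≫ l ≅ h ≫ k ≫ l)
  leftUnitor {A B} h := (isoMk (λ_ h.hom) : 𝟙 A ≫ h ≅ h)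
  rightUnitor {A B} h := (isoMk (ρ_ h.hom) : h ≫ 𝟙 B ≅ h)
  whisker_exchange s t := by ext; simpa using whisker_exchange s.hom t.hom

theorem eqToHom_hom₂ {A B : Kleisli D} {h k : A ⟶ B} (e : h = k) :
    (eqToIso e).hom.hom = (eqToIso (congrArg Hom.hom e)).hom := by
  subst e; rfl

/-- The Kleisli bicategory is a 2-category if `K` is one. -/
instance [Strict K] : Strict (Kleisli D) where
  id_comp h := hom_ext (Strict.id_comp h.hom)
  comp_id h := hom_ext (Strict.comp_id h.hom)
  assoc h k l := hom_ext (Strict.assoc h.hom k.hom l.hom)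
  leftUnitor_eqToIso h := by
    ext
    refine Eq.trans ?_ (eqToHom_hom₂ _).symm
    exact congrArg Iso.hom (Strict.leftUnitor_eqToIso h.hom)
  rightUnitor_eqToIso h := by
    ext
    refine Eq.trans ?_ (eqToHom_hom₂ _).symm
    exact congrArg Iso.hom (Strict.rightUnitor_eqToIso h.hom)
  associator_eqToIso h k l := by
    ext
    refine Eq.trans ?_ (eqToHom_hom₂ _).symm
    exact congrArg Iso.hom (Strict.associator_eqToIso h.hom k.hom l.hom)

end Kleisli

end Kleisli

end ReflLimit

/-! ### The bicategory of small profunctors -/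

namespace ReflLimit

universe u

open Opposite Limits

section SmallPresheaf

variable {B : Type (u + 1)} [Category.{u} B]

/-- A presheaf is small if it is a colimit of representables indexed by a small category. -/
class IsSmallPresheaf (P : Bᵒᵖ ⥤ Type u) : Prop where
  exists_colimit : ∃ (I : Type u) (_ : SmallCategory I) (X : I ⥤ B)
    (ι : X ⋙ yoneda ⟶ (Functor.const I).obj P), Nonempty (IsColimit (Cocone.mk P ι))

/-- Universal elements exhibiting a small presheaf as a colimit of representables. -/
theorem IsSmallPresheaf.exists_gen (P : Bᵒᵖ ⥤ Type u) [hP : IsSmallPresheaf P] :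
    ∃ (I : Type u) (_ : SmallCategory I) (X : I ⥤ B) (e : ∀ i, P.obj (op (X.obj i))),
      (∀ {i j : I} (r : i ⟶ j), P.map (X.map r).op (e j) = e i) ∧
      (∀ (b : B) (p : P.obj (op b)), ∃ (i : I) (φ : b ⟶ X.obj i), P.map φ.op (e i) = p) ∧
      (∀ (b : B) (T : Type u) (k : ∀ i, (b ⟶ X.obj i) → T),
        (∀ {i j : I} (r : i ⟶ j) (φ : b ⟶ X.obj i), k i φ = k j (φ ≫ X.map r)) →
        ∃ d : P.obj (op b) → T, ∀ (i : I) (φ : b ⟶ X.obj i), d (P.map φ.op (e i)) = k i φ) := by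
  obtain ⟨I, _, X, ι, ⟨hι⟩⟩ := hP.exists_colimit
  have key : ∀ (b : B) (i : I) (φ : b ⟶ X.obj i),
      P.map φ.op ((ι.app i).app (op (X.obj i)) (𝟙 (X.obj i))) = (ι.app i).app (op b) φ := by
    intro b i φ
    have h := NatTrans.naturality_apply (ι.app i) φ.op (𝟙 (X.obj i))
    have h' : (yoneda.obj (X.obj i)).map φ.op (𝟙 (X.obj i)) = φ := by simp
    refine h.symm.trans ?_
    exact congrArg ((ι.app i).app (op b)) h'
  have nat : ∀ (b : B) {i j : I} (r : i ⟶ j) (φ : b ⟶ X.obj i),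
      (ι.app j).app (op b) (φ ≫ X.map r) = (ι.app i).app (op b) φ := by
    intro b i j r φ
    have h := ι.naturality r
    have h' := congrArg (fun (t : yoneda.obj (X.obj i) ⟶ P) => t.app (op b) φ) h
    exact h'
  have hev := fun b : B => isColimitOfPreserves ((evaluation Bᵒᵖ (Type u)).obj (op b)) hι
  refine ⟨I, inferInstance, X, fun i => (ι.app i).app _ (𝟙 (X.obj i)), ?_, ?_, ?_⟩
  · intro i j r
    rw [key]
    have := nat (X.obj i) r (𝟙 _)
    rw [Category.id_comp] at this
    exact this
  · intro b p
    obtain ⟨i, φ, h⟩ := Types.jointly_surjective_of_isColimit (hev b) p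
    exact ⟨i, φ, (key b i φ).trans h⟩
  · intro b T k hk
    refine ⟨(hev b).desc ⟨T, ⟨fun i => ↾(fun φ => k i φ), ?_⟩⟩, ?_⟩
    · intro i j r
      ext φ
      exact (hk r φ).symm
    · intro i φ
      rw [key]
      have := ConcreteCategory.congr_hom
        ((hev b).fac ⟨T, ⟨fun i => ↾(fun φ => k i φ), by
          intro i j r; ext φ; exact (hk r φ).symm⟩⟩ i) φ
      exact this

/-- The category of elements of `P` restricted to a family of objects of `B`. -/
structure El (P : Bᵒᵖ ⥤ Type u) {I : Type u} (S : I → B) : Type u where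
  /-- The index of the object. -/
  idx : I
  /-- The element. -/
  elt : P.obj (op (S idx))

instance (P : Bᵒᵖ ⥤ Type u) {I : Type u} (S : I → B) : SmallCategory (El P S) where
  Hom x y := { g : S x.idx ⟶ S y.idx // P.map g.op y.elt = x.elt }
  id x := ⟨𝟙 _, by simp⟩
  comp f g := ⟨f.1 ≫ g.1, by simp [f.2, g.2]⟩

theorem isSmallPresheaf_of_family (P : Bᵒᵖ ⥤ Type u) {I : Type u} (S : I → B)
    (gen : ∀ (b : B) (p : P.obj (op b)),
      ∃ (i : I) (s : P.obj (op (S i))) (φ : b ⟶ S i), P.map φ.op s = p)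
    (rel : ∀ (b : B) (T : Type u) (k : ∀ i, (b ⟶ S i) → P.obj (op (S i)) → T),
      (∀ {i j : I} (g : S i ⟶ S j) (φ : b ⟶ S i) (s : P.obj (op (S j))),
        k i φ (P.map g.op s) = k j (φ ≫ g) s) →
      ∃ d : P.obj (op b) → T, ∀ i φ s, d (P.map φ.op s) = k i φ s) :
    IsSmallPresheaf P := by
  let X : El P S ⥤ B := { obj := fun x => S x.idx, map := fun f => f.1 }
  let ι : X ⋙ yoneda ⟶ (Functor.const (El P S)).obj P :=
    { app := fun x =>
        { app := fun b => ↾(fun (φ : unop b ⟶ S x.idx) => P.map φ.op x.elt)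
          naturality := by
            intro b b' g
            ext φ
            exact P.map_comp_apply φ.op g x.elt }
      naturality := by
        intro x y f
        ext b φ
        change P.map ((φ : unop b ⟶ S x.idx) ≫ f.1).op y.elt = P.map (Quiver.Hom.op φ) x.elt
        exact (P.map_comp_apply f.1.op (Quiver.Hom.op φ) y.elt).trans
          (congrArg (P.map (Quiver.Hom.op φ)) f.2) }
  have hd : ∀ (s : Cocone (X ⋙ yoneda)) (b : B), ∃ d : P.obj (op b) → s.pt.obj (op b),
      ∀ (x : El P S) (φ : b ⟶ S x.idx),
        d (P.map φ.op x.elt) = (s.ι.app x).app (op b) φ := by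
    intro s b
    obtain ⟨d, h⟩ := rel b (s.pt.obj (op b))
      (fun i φ e => (s.ι.app (⟨i, e⟩ : El P S)).app (op b) φ) (by
        intro i j g φ e
        have h := s.w (j' := (⟨i, P.map g.op e⟩ : El P S)) (j := (⟨j, e⟩ : El P S)) ⟨g, rfl⟩
        exact (congrArg (fun (t : yoneda.obj (S i) ⟶ s.pt) => t.app (op b) φ) h).symm)
    exact ⟨d, fun x φ => h x.idx φ x.elt⟩
  choose d hd using hd
  refine ⟨El P S, inferInstance, X, ι, ⟨({
    desc := fun s =>
      { app := fun b => ↾(d s b.unop)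
        naturality := ?_ }
    fac := ?_
    uniq := ?_ } : IsColimit (Cocone.mk P ι))⟩⟩
  · intro b b' g
    ext p
    obtain ⟨i, e, φ, rfl⟩ := gen b.unop p
    have h1 := hd s b'.unop ⟨i, e⟩ (g.unop ≫ φ)
    have h2 := hd s b.unop ⟨i, e⟩ φ
    have h3 := NatTrans.naturality_apply (s.ι.app (⟨i, e⟩ : El P S)) g φ
    have h4 : P.map g (P.map φ.op e) = P.map (g.unop ≫ φ).op e :=
      (P.map_comp_apply φ.op g e).symm
    change d s b'.unop (P.map g (P.map φ.op e)) = s.pt.map g (d s b.unop (P.map φ.op e))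
    rw [h4, h1, h2]
    exact h3
  · intro s x
    ext b φ
    exact hd s b.unop x φ
  · intro s m hm
    ext b p
    obtain ⟨i, e, φ, rfl⟩ := gen b.unop p
    refine Eq.trans ?_ (hd s b.unop ⟨i, e⟩ φ).symm
    exact congrArg (fun (t : yoneda.obj (S i) ⟶ s.pt) => t.app b φ) (hm ⟨i, e⟩)

instance isSmallPresheaf_yoneda (b : B) : IsSmallPresheaf (yoneda.obj b) := by
  refine isSmallPresheaf_of_family _ (fun _ : PUnit.{u + 1} => b) ?_ ?_
  · intro b' p
    exact ⟨⟨⟩, 𝟙 b, p, Category.comp_id (p : b' ⟶ b)⟩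
  · intro b' T k hk
    refine ⟨fun p => k ⟨⟩ p (𝟙 b), ?_⟩
    rintro ⟨⟩ φ s
    have := hk (i := ⟨⟩) (j := ⟨⟩) s φ (𝟙 b)
    refine this.symm.trans ?_
    exact congrArg (k ⟨⟩ φ) (Category.comp_id (s : b ⟶ b))

end SmallPresheaf

noncomputable section

section Tens

variable {B C : Type (u + 1)} [Category.{u} B] [Category.{u} C]

/-- The relation defining the coend `∫^b P b × G(c, b)`. -/
inductive TensRel (P : Bᵒᵖ ⥤ Type u) (G : Profunctor.{u} B C) (c : Cᵒᵖ) :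
    (Σ b : B, P.obj (op b) × (G.obj b).obj c) → (Σ b : B, P.obj (op b) × (G.obj b).obj c) → Prop
  | intro {b b' : B} (g : b ⟶ b') (p : P.obj (op b')) (x : (G.obj b).obj c) :
      TensRel P G c ⟨b, P.map g.op p, x⟩ ⟨b', p, (G.map g).app c x⟩

instance small_tens (P : Bᵒᵖ ⥤ Type u) [IsSmallPresheaf P] (G : Profunctor.{u} B C)
    (c : Cᵒᵖ) : Small.{u} (Quot (TensRel P G c)) := by
  obtain ⟨I, _, X, e, -, gen, -⟩ := IsSmallPresheaf.exists_gen P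
  refine small_of_surjective (α := Σ i : I, (G.obj (X.obj i)).obj c)
    (f := fun t => Quot.mk (TensRel P G c) ⟨X.obj t.1, e t.1, t.2⟩) ?_
  rintro ⟨b, p, x⟩
  obtain ⟨i, φ, rfl⟩ := gen b p
  exact ⟨⟨i, (G.map φ).app c x⟩, (Quot.sound (.intro φ (e i) x)).symm⟩

/-- The coend `∫^b P b × G(c, b)`, for a small presheaf `P`. -/
def Tens (P : Bᵒᵖ ⥤ Type u) [IsSmallPresheaf P] (G : Profunctor.{u} B C) (c : Cᵒᵖ) : Type u :=
  Shrink.{u} (Quot (TensRel P G c))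

namespace Tens

variable {P P' P'' : Bᵒᵖ ⥤ Type u} [IsSmallPresheaf P] [IsSmallPresheaf P'] [IsSmallPresheaf P'']
  {G G' G'' : Profunctor.{u} B C} {c : Cᵒᵖ}

/-- The class of a pair of elements. -/
def mk (b : B) (p : P.obj (op b)) (x : (G.obj b).obj c) : Tens P G c :=
  equivShrink _ (Quot.mk _ ⟨b, p, x⟩)

theorem sound {b b' : B} (g : b ⟶ b') (p : P.obj (op b')) (x : (G.obj b).obj c) :
    (mk b (P.map g.op p) x : Tens P G c) = mk b' p ((G.map g).app c x) :=
  congrArg (equivShrink _) (Quot.sound (.intro g p x))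

theorem ind {motive : Tens P G c → Prop} (h : ∀ b p x, motive (mk b p x)) (t : Tens P G c) :
    motive t := by
  obtain ⟨⟨b, p, x⟩, rfl⟩ := (equivShrink (Quot (TensRel P G c))).surjective t
  exact h b p x

/-- The universal property of the coend. -/
def lift {T : Type*} (k : ∀ b, P.obj (op b) → (G.obj b).obj c → T)
    (hk : ∀ ⦃b b' : B⦄ (g : b ⟶ b') p x, k b (P.map g.op p) x = k b' p ((G.map g).app c x)) :
    Tens P G c → T := fun t =>
  Quot.lift (fun s => k s.1 s.2.1 s.2.2) (by rintro _ _ ⟨g, p, x⟩; exact hk g p x)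
    ((equivShrink _).symm t)

@[simp]
theorem lift_mk {T : Type*} (k : ∀ b, P.obj (op b) → (G.obj b).obj c → T)
    (hk : ∀ ⦃b b' : B⦄ (g : b ⟶ b') p x, k b (P.map g.op p) x = k b' p ((G.map g).app c x))
    (b : B) (p : P.obj (op b)) (x : (G.obj b).obj c) : lift k hk (mk b p x) = k b p x := by
  simp [lift, mk]

/-- The action of a morphism on the coend. -/
def act {c' : Cᵒᵖ} (f : c ⟶ c') : Tens P G c → Tens P G c' :=
  lift (fun b p x => mk b p ((G.obj b).map f x)) fun b b' g p x => by
    rw [sound]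
    exact congrArg (mk b' p) (NatTrans.naturality_apply (G.map g) f x)

theorem act_mk {c' : Cᵒᵖ} (f : c ⟶ c') (b : B) (p : P.obj (op b)) (x : (G.obj b).obj c) :
    act f (mk b p x : Tens P G c) = mk b p ((G.obj b).map f x) :=
  lift_mk _ _ _ _ _

variable (P G) in
/-- The coend as a presheaf in the remaining variable. -/
def presheaf : Cᵒᵖ ⥤ Type u where
  obj c := Tens P G c
  map f := ↾(act f)
  map_id c := by
    ext t
    induction t using ind with | h b p x
    refine (act_mk (𝟙 c) b p x).trans ?_
    exact congrArg (mk b p) (Functor.map_id_apply (G.obj b) _ x)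
  map_comp {c c' c''} f g := by
    ext t
    induction t using ind with | h b p x
    change act (f ≫ g) (mk b p x : Tens P G c) = act g (act f (mk b p x))
    rw [act_mk, act_mk, act_mk]
    exact congrArg (mk b p) (Functor.map_comp_apply (G.obj b) f g x)

theorem presheaf_map_mk {c' : Cᵒᵖ} (f : c ⟶ c') (b : B) (p : P.obj (op b))
    (x : (G.obj b).obj c) :
    (presheaf P G).map f (mk b p x : Tens P G c) = (mk b p ((G.obj b).map f x) : Tens P G c') :=
  act_mk _ _ _ _

/-- Functoriality of the coend in both arguments, at an object. -/
def mapApp (σ : P ⟶ P') (τ : G ⟶ G') (c : Cᵒᵖ) : Tens P G c → Tens P' G' c :=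
  lift (fun b p x => mk b (σ.app _ p) ((τ.app b).app c x)) fun b b' g p x => by
    have h : σ.app (op b) (P.map g.op p) = P'.map g.op (σ.app _ p) :=
      NatTrans.naturality_apply σ g.op p
    rw [h, sound]
    exact congrArg (mk b' _)
      (congrArg (fun (t : G.obj b ⟶ G'.obj b') => t.app c x) (τ.naturality g)).symm

theorem mapApp_mk (σ : P ⟶ P') (τ : G ⟶ G') (b : B) (p : P.obj (op b)) (x : (G.obj b).obj c) :
    mapApp σ τ c (mk b p x) = mk b (σ.app _ p) ((τ.app b).app c x) :=
  lift_mk _ _ _ _ _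

/-- Functoriality of the coend in both arguments. -/
def map (σ : P ⟶ P') (τ : G ⟶ G') : presheaf P G ⟶ presheaf P' G' where
  app c := ↾(mapApp σ τ c)
  naturality c c' f := by
    ext t
    induction t using ind with | h b p x
    change mapApp σ τ c' (act f (mk b p x)) = act f (mapApp σ τ c (mk b p x))
    rw [act_mk, mapApp_mk, mapApp_mk, act_mk]
    exact congrArg (mk b _) (NatTrans.naturality_apply (τ.app b) f x)

theorem map_mk (σ : P ⟶ P') (τ : G ⟶ G') (b : B) (p : P.obj (op b)) (x : (G.obj b).obj c) :
    (map σ τ).app c (mk b p x : Tens P G c) =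
      (mk b (σ.app _ p) ((τ.app b).app c x) : Tens P' G' c) :=
  mapApp_mk _ _ _ _ _

/-- Two natural transformations out of a coend agree if they agree on classes of pairs. -/
theorem hom_ext {Q : Cᵒᵖ ⥤ Type u} {s t : presheaf P G ⟶ Q}
    (h : ∀ c b p x, s.app c (mk b p x : Tens P G c) = t.app c (mk b p x : Tens P G c)) :
    s = t := by
  ext c z
  induction z using ind with | h b p x
  exact h c b p x

/-- The coend of small presheaves, weighted by a small presheaf, is small. -/
instance [∀ b, IsSmallPresheaf (G.obj b)] : IsSmallPresheaf (presheaf P G) := by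
  obtain ⟨I, _, X, e, he, gen, desc⟩ := IsSmallPresheaf.exists_gen P
  choose I' _ X' e' he' gen' desc' using fun b => IsSmallPresheaf.exists_gen (G.obj b)
  refine isSmallPresheaf_of_family _
    (fun t : (Σ i : I, I' (X.obj i)) => (X' (X.obj t.1)).obj t.2) ?_ ?_
  · intro c z
    induction z using ind with | h b p x
    obtain ⟨i, φ, rfl⟩ := gen b p
    obtain ⟨l, ψ, hψ⟩ := gen' _ _ ((G.map φ).app _ x)
    refine ⟨⟨i, l⟩, (mk (X.obj i) (e i) (e' _ l) : Tens P G _), ψ, ?_⟩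
    rw [presheaf_map_mk, sound]
    exact congrArg (mk (X.obj i) (e i)) hψ
  · intro c T k hk
    let m (i : I) (l : I' (X.obj i)) : Tens P G (op ((X' (X.obj i)).obj l)) :=
      mk (X.obj i) (e i) (e' _ l)
    have hm : ∀ i l (z : C) (ψ : z ⟶ (X' (X.obj i)).obj l),
        (presheaf P G).map ψ.op (m i l) =
          (mk (X.obj i) (e i) ((G.obj (X.obj i)).map ψ.op (e' _ l)) : Tens P G (op z)) :=
      fun i l z ψ => presheaf_map_mk _ _ _ _
    have hf : ∀ i, ∃ f : (G.obj (X.obj i)).obj (op c) → T,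
        ∀ l (ψ : c ⟶ (X' (X.obj i)).obj l),
          f ((G.obj (X.obj i)).map ψ.op (e' _ l)) = k ⟨i, l⟩ ψ (m i l) := by
      intro i
      refine desc' (X.obj i) c T (fun l ψ => k ⟨i, l⟩ ψ (m i l)) ?_
      intro l l' r ψ
      refine Eq.trans ?_ (hk (i := ⟨i, l⟩) (j := ⟨i, l'⟩) ((X' (X.obj i)).map r) ψ (m i l'))
      refine congrArg (k ⟨i, l⟩ ψ) (Eq.symm ((hm i l' _ _).trans ?_))
      exact congrArg (mk (X.obj i) (e i)) (he' (X.obj i) r)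
    choose f hf using hf
    have hfr : ∀ {i j : I} (r : i ⟶ j) (x : (G.obj (X.obj i)).obj (op c)),
        f i x = f j ((G.map (X.map r)).app _ x) := by
      intro i j r x
      obtain ⟨l, ψ, rfl⟩ := gen' _ _ x
      obtain ⟨l', χ, hχ⟩ := gen' _ _ ((G.map (X.map r)).app _ (e' _ l))
      have h₁ : (G.map (X.map r)).app _ ((G.obj (X.obj i)).map ψ.op (e' _ l)) =
          (G.obj (X.obj j)).map (ψ ≫ χ).op (e' _ l') := by
        refine (NatTrans.naturality_apply (G.map (X.map r)) ψ.op (e' _ l)).trans ?_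
        refine (congrArg ((G.obj (X.obj j)).map ψ.op) hχ.symm).trans ?_
        exact (Functor.map_comp_apply (G.obj (X.obj j)) χ.op ψ.op (e' _ l')).symm
      rw [h₁, hf, hf]
      refine Eq.trans ?_ (hk (i := ⟨i, l⟩) (j := ⟨j, l'⟩) χ ψ (m j l'))
      refine congrArg (k ⟨i, l⟩ ψ) (Eq.symm ((hm j l' _ χ).trans ?_))
      rw [hχ, ← sound, he]
    have hdd : ∀ b : B, ∃ d : P.obj (op b) → ((G.obj b).obj (op c) → T),
        ∀ i (φ : b ⟶ X.obj i), d (P.map φ.op (e i)) = fun x => f i ((G.map φ).app _ x) := by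
      intro b
      refine desc b _ (fun i φ x => f i ((G.map φ).app _ x)) ?_
      intro i j r φ
      funext x
      rw [hfr r]
      exact congrArg (f j) (congrArg (fun (t : G.obj b ⟶ G.obj (X.obj j)) => t.app (op c) x)
        (G.map_comp φ (X.map r))).symm
    choose d hd using hdd
    refine ⟨lift d ?_, ?_⟩
    · intro b b' g p x
      obtain ⟨i, φ, rfl⟩ := gen b' p
      have h₁ : P.map g.op (P.map φ.op (e i)) = P.map (g ≫ φ).op (e i) :=
        (P.map_comp_apply φ.op g.op (e i)).symm
      rw [h₁, hd, hd]
      exact congrArg (f i) (congrArg (fun (t : G.obj b ⟶ G.obj (X.obj i)) => t.app (op c) x)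
        (G.map_comp g φ))
    · intro t φ s
      obtain ⟨i, l, ψ, rfl⟩ : ∃ i l, ∃ ψ : (X' (X.obj t.1)).obj t.2 ⟶ (X' (X.obj i)).obj l,
          (presheaf P G).map ψ.op (m i l) = s := by
        induction s using ind with | h b p x
        obtain ⟨i, ρ, rfl⟩ := gen b p
        obtain ⟨l, ψ, hψ⟩ := gen' _ _ ((G.map ρ).app _ x)
        refine ⟨i, l, ψ, ?_⟩
        rw [hm, sound, hψ]
      have h₁ : (presheaf P G).map φ.op ((presheaf P G).map ψ.op (m i l)) =
          (presheaf P G).map (φ ≫ ψ).op (m i l) :=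
        ((presheaf P G).map_comp_apply ψ.op φ.op (m i l)).symm
      have h₂ := hd (X.obj i) i (𝟙 _)
      have h₃ : P.map (𝟙 (X.obj i)).op (e i) = e i := Functor.map_id_apply P _ (e i)
      rw [h₃] at h₂
      rw [h₁, hm, lift_mk, h₂, G.map_id]
      refine Eq.trans (hf i l (φ ≫ ψ)) ?_
      exact (hk (i := t) (j := ⟨i, l⟩) ψ φ (m i l)).symm

end Tens

end Tens

/-- A small profunctor `A ⇝ B`: a functor `Bᵒᵖ × A ⥤ Set`, in curried form, whose presheaves
`H(-, a)` on `B` are small. -/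
structure SmallProfunctor (A B : Type (u + 1)) [Category.{u} A] [Category.{u} B] where
  /-- The underlying profunctor. -/
  prof : Profunctor.{u} A B
  /-- It is small. -/
  small (a : A) : IsSmallPresheaf (prof.obj a)

namespace SmallProfunctor

attribute [instance] SmallProfunctor.small

variable {A B C D : Type (u + 1)} [Category.{u} A] [Category.{u} B] [Category.{u} C]
  [Category.{u} D]

variable (A) in
/-- The identity profunctor, given by the hom-sets of `A`. -/
def id : SmallProfunctor A A where
  prof := yoneda
  small a := isSmallPresheaf_yoneda a

/-- Composition of small profunctors by coends. -/
def comp (H : SmallProfunctor A B) (G : SmallProfunctor B C) : SmallProfunctor A C where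
  prof :=
    { obj := fun a => Tens.presheaf (H.prof.obj a) G.prof
      map := fun f => Tens.map (H.prof.map f) (𝟙 G.prof)
      map_id := fun a => Tens.hom_ext fun c b p x => by
        rw [Tens.map_mk, H.prof.map_id]
        rfl
      map_comp := fun f g => Tens.hom_ext fun c b p x => by
        rw [Tens.map_mk, H.prof.map_comp]
        change _ = (Tens.map _ _).app c ((Tens.map _ _).app c (Tens.mk b p x))
        rw [Tens.map_mk, Tens.map_mk]
        rfl }
  small a := (inferInstance : IsSmallPresheaf (Tens.presheaf (H.prof.obj a) G.prof))

/-- Transformations of small profunctors. -/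
@[ext]
structure Hom (H G : SmallProfunctor A B) where
  /-- The underlying natural transformation. -/
  hom : H.prof ⟶ G.prof

instance : Category (SmallProfunctor A B) where
  Hom H G := Hom H G
  id H := ⟨𝟙 H.prof⟩
  comp s t := ⟨s.hom ≫ t.hom⟩

/-- The effect of a transformation on an element. -/
def Hom.ap {H G : SmallProfunctor A B} (s : Hom H G) {a : A} {b : Bᵒᵖ}
    (h : (H.prof.obj a).obj b) : (G.prof.obj a).obj b :=
  (s.hom.app a).app b h

theorem hom_ext {H G : SmallProfunctor A B} {s t : H ⟶ G}
    (w : ∀ a b (h : (H.prof.obj a).obj b), Hom.ap s h = Hom.ap t h) : s = t := by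
  apply Hom.ext
  ext a b h
  exact w a b h

theorem ap_map {H G : SmallProfunctor A B} (s : H ⟶ G) {a : A} {b b' : Bᵒᵖ} (f : b ⟶ b')
    (h : (H.prof.obj a).obj b) :
    Hom.ap s ((H.prof.obj a).map f h) = (G.prof.obj a).map f (Hom.ap s h) :=
  NatTrans.naturality_apply (s.hom.app a) f h

theorem ap_id {H : SmallProfunctor A B} {a : A} {b : Bᵒᵖ} (h : (H.prof.obj a).obj b) :
    Hom.ap (𝟙 H) h = h := rfl

theorem ap_comp {H G K : SmallProfunctor A B} (s : H ⟶ G) (t : G ⟶ K) {a : A} {b : Bᵒᵖ}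
    (h : (H.prof.obj a).obj b) : Hom.ap (s ≫ t) h = Hom.ap t (Hom.ap s h) := rfl

/-- The class of a pair of elements in a composite. -/
def pair {H : SmallProfunctor A B} {G : SmallProfunctor B C} {a : A} {c : Cᵒᵖ} (b : B)
    (h : (H.prof.obj a).obj (op b)) (x : (G.prof.obj b).obj c) : ((H.comp G).prof.obj a).obj c :=
  Tens.mk b h x

theorem pair_sound {H : SmallProfunctor A B} {G : SmallProfunctor B C} {a : A} {c : Cᵒᵖ} {b b' : B}
    (g : b ⟶ b') (h : (H.prof.obj a).obj (op b')) (x : (G.prof.obj b).obj c) :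
    (pair b ((H.prof.obj a).map g.op h) x : ((H.comp G).prof.obj a).obj c) =
      pair b' h ((G.prof.map g).app c x) :=
  Tens.sound g h x

theorem pair_ind {H : SmallProfunctor A B} {G : SmallProfunctor B C} {a : A} {c : Cᵒᵖ}
    {motive : ((H.comp G).prof.obj a).obj c → Prop} (w : ∀ b h x, motive (pair b h x))
    (t : ((H.comp G).prof.obj a).obj c) : motive t :=
  Tens.ind w t

theorem map_pair {H : SmallProfunctor A B} {G : SmallProfunctor B C} {a : A} {c c' : Cᵒᵖ}
    (f : c ⟶ c') (b : B) (h : (H.prof.obj a).obj (op b)) (x : (G.prof.obj b).obj c) :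
    ((H.comp G).prof.obj a).map f (pair b h x) = pair b h ((G.prof.obj b).map f x) :=
  Tens.presheaf_map_mk f b h x

theorem map_app_pair {H : SmallProfunctor A B} {G : SmallProfunctor B C} {a a' : A} {c : Cᵒᵖ}
    (f : a ⟶ a') (b : B) (h : (H.prof.obj a).obj (op b)) (x : (G.prof.obj b).obj c) :
    ((H.comp G).prof.map f).app c (pair b h x) = pair b ((H.prof.map f).app _ h) x :=
  Tens.map_mk (H.prof.map f) (𝟙 G.prof) b h x

/-- Transformations out of a composite. -/
def homMk {H : SmallProfunctor A B} {G : SmallProfunctor B C} {K : SmallProfunctor A C}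
    (k : ∀ {a : A} {c : Cᵒᵖ} (b : B), (H.prof.obj a).obj (op b) → (G.prof.obj b).obj c →
      (K.prof.obj a).obj c)
    (sound : ∀ {a : A} {c : Cᵒᵖ} ⦃b b' : B⦄ (g : b ⟶ b') (h : (H.prof.obj a).obj (op b'))
      (x : (G.prof.obj b).obj c), k b ((H.prof.obj a).map g.op h) x = k b' h ((G.prof.map g).app c x))
    (nat : ∀ {a : A} {c c' : Cᵒᵖ} (f : c ⟶ c') (b : B) (h : (H.prof.obj a).obj (op b))
      (x : (G.prof.obj b).obj c), k b h ((G.prof.obj b).map f x) = (K.prof.obj a).map f (k b h x))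
    (nat' : ∀ {a a' : A} {c : Cᵒᵖ} (f : a ⟶ a') (b : B) (h : (H.prof.obj a).obj (op b))
      (x : (G.prof.obj b).obj c), k b ((H.prof.map f).app _ h) x = (K.prof.map f).app c (k b h x)) :
    H.comp G ⟶ K where
  hom :=
    { app := fun a =>
        { app := fun c => ↾(Tens.lift (P := H.prof.obj a) (G := G.prof) (c := c) k sound)
          naturality := fun c c' f => by
            ext t
            induction t using pair_ind with | w b h x
            change Tens.lift k sound (((H.comp G).prof.obj a).map f (pair b h x)) =
              (K.prof.obj a).map f (Tens.lift k sound (pair b h x))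
            rw [map_pair]
            refine (Tens.lift_mk _ _ _ _ _).trans ((nat f b h x).trans ?_)
            exact congrArg ((K.prof.obj a).map f) (Tens.lift_mk k sound b h x).symm }
      naturality := fun a a' f => by
        ext c t
        induction t using pair_ind with | w b h x
        change Tens.lift k sound (((H.comp G).prof.map f).app c (pair b h x)) =
          (K.prof.map f).app c (Tens.lift k sound (pair b h x))
        rw [map_app_pair]
        refine (Tens.lift_mk _ _ _ _ _).trans ((nat' f b h x).trans ?_)
        exact congrArg ((K.prof.map f).app c) (Tens.lift_mk k sound b h x).symm }

theorem ap_homMk {H : SmallProfunctor A B} {G : SmallProfunctor B C} {K : SmallProfunctor A C}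
    (k : ∀ {a : A} {c : Cᵒᵖ} (b : B), (H.prof.obj a).obj (op b) → (G.prof.obj b).obj c →
      (K.prof.obj a).obj c) (sound nat nat') {a : A} {c : Cᵒᵖ} (b : B)
    (h : (H.prof.obj a).obj (op b)) (x : (G.prof.obj b).obj c) :
    Hom.ap (homMk (K := K) k sound nat nat') (pair b h x) = k b h x :=
  Tens.lift_mk k sound b h x

theorem hom_ext_pair {H : SmallProfunctor A B} {G : SmallProfunctor B C} {K : SmallProfunctor A C}
    {s t : H.comp G ⟶ K}
    (w : ∀ {a : A} {c : Cᵒᵖ} (b : B) (h : (H.prof.obj a).obj (op b)) (x : (G.prof.obj b).obj c),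
      Hom.ap s (pair b h x) = Hom.ap t (pair b h x)) : s = t :=
  hom_ext fun a c z => by
    induction z using pair_ind with | w b h x
    exact w b h x

/-- Whiskering on the left. -/
def whiskerLeft (H : SmallProfunctor A B) {G K : SmallProfunctor B C} (τ : G ⟶ K) :
    H.comp G ⟶ H.comp K :=
  homMk (fun b h x => pair b h (Hom.ap τ x))
    (fun {a c} b b' g h x => by
      rw [pair_sound]
      exact congrArg (pair b' h)
        (congrArg (fun (t : G.prof.obj b ⟶ K.prof.obj b') => t.app c x) (τ.hom.naturality g)).symm)
    (fun f b h x => by rw [map_pair, ap_map])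
    (fun f b h x => by rw [map_app_pair])

theorem ap_app {H G : SmallProfunctor A B} (s : H ⟶ G) {a a' : A} {b : Bᵒᵖ} (f : a ⟶ a')
    (h : (H.prof.obj a).obj b) :
    Hom.ap s ((H.prof.map f).app b h) = (G.prof.map f).app b (Hom.ap s h) :=
  congrArg (fun (t : H.prof.obj a ⟶ G.prof.obj a') => t.app b h) (s.hom.naturality f)

/-- Whiskering on the right. -/
def whiskerRight {H K : SmallProfunctor A B} (σ : H ⟶ K) (G : SmallProfunctor B C) :
    H.comp G ⟶ K.comp G :=
  homMk (fun b h x => pair b (Hom.ap σ h) x)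
    (fun {a c} b b' g h x => by rw [ap_map, pair_sound])
    (fun f b h x => by rw [map_pair])
    (fun f b h x => by rw [map_app_pair, ap_app])

theorem ap_whiskerLeft (H : SmallProfunctor A B) {G K : SmallProfunctor B C} (τ : G ⟶ K)
    {a : A} {c : Cᵒᵖ} (b : B) (h : (H.prof.obj a).obj (op b)) (x : (G.prof.obj b).obj c) :
    Hom.ap (whiskerLeft H τ) (pair b h x) = pair b h (Hom.ap τ x) :=
  ap_homMk _ _ _ _ b h x

theorem ap_whiskerRight {H K : SmallProfunctor A B} (σ : H ⟶ K) (G : SmallProfunctor B C)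
    {a : A} {c : Cᵒᵖ} (b : B) (h : (H.prof.obj a).obj (op b)) (x : (G.prof.obj b).obj c) :
    Hom.ap (whiskerRight σ G) (pair b h x) = pair b (Hom.ap σ h) x :=
  ap_homMk (K := K.comp G) (fun b h x => pair b (Hom.ap σ h) x) _ _ _ b h x

/-- An isomorphism from two inverse transformations. -/
def isoMk {H G : SmallProfunctor A B} (s : H ⟶ G) (t : G ⟶ H)
    (st : ∀ {a : A} {b : Bᵒᵖ} (h : (H.prof.obj a).obj b), Hom.ap t (Hom.ap s h) = h)
    (ts : ∀ {a : A} {b : Bᵒᵖ} (h : (G.prof.obj a).obj b), Hom.ap s (Hom.ap t h) = h) :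
    H ≅ G where
  hom := s
  inv := t
  hom_inv_id := hom_ext fun _ _ h => st h
  inv_hom_id := hom_ext fun _ _ h => ts h

/-- Functions out of the set of elements of a composite. -/
def pairLift {T : Type u} {H : SmallProfunctor A B} {G : SmallProfunctor B C} {a : A} {c : Cᵒᵖ}
    (k : ∀ b, (H.prof.obj a).obj (op b) → (G.prof.obj b).obj c → T)
    (sound : ∀ ⦃b b' : B⦄ (g : b ⟶ b') (h : (H.prof.obj a).obj (op b'))
      (x : (G.prof.obj b).obj c),
      k b ((H.prof.obj a).map g.op h) x = k b' h ((G.prof.map g).app c x)) :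
    ((H.comp G).prof.obj a).obj c → T :=
  Tens.lift k sound

theorem pairLift_pair {T : Type u} {H : SmallProfunctor A B} {G : SmallProfunctor B C} {a : A}
    {c : Cᵒᵖ} (k : ∀ b, (H.prof.obj a).obj (op b) → (G.prof.obj b).obj c → T) (sound) (b : B)
    (h : (H.prof.obj a).obj (op b)) (x : (G.prof.obj b).obj c) :
    pairLift (H := H) (G := G) k sound (pair b h x) = k b h x :=
  Tens.lift_mk k sound b h x

section Associator

variable (H : SmallProfunctor A B) (G : SmallProfunctor B C) (K : SmallProfunctor C D)

/-- The associator on pairs. -/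
def assocFun {a : A} {d : Dᵒᵖ} (c : C) (z : ((H.comp G).prof.obj a).obj (op c))
    (k : (K.prof.obj c).obj d) : ((H.comp (G.comp K)).prof.obj a).obj d :=
  pairLift (H := H) (G := G) (fun b h x => (pair b h (pair c x k : ((G.comp K).prof.obj b).obj d) :
    ((H.comp (G.comp K)).prof.obj a).obj d))
    (fun b b' g h x => by rw [pair_sound, map_app_pair]) z

theorem assocFun_pair {a : A} {d : Dᵒᵖ} (b : B) (c : C) (h : (H.prof.obj a).obj (op b))
    (x : (G.prof.obj b).obj (op c)) (k : (K.prof.obj c).obj d) :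
    assocFun H G K c (pair b h x) k = pair b h (pair c x k) :=
  pairLift_pair _ _ b h x

/-- The inverse of the associator on pairs. -/
def assocInvFun {a : A} {d : Dᵒᵖ} (b : B) (h : (H.prof.obj a).obj (op b))
    (w : ((G.comp K).prof.obj b).obj d) : (((H.comp G).comp K).prof.obj a).obj d :=
  pairLift (H := G) (G := K) (fun c x k => (pair c (pair b h x : ((H.comp G).prof.obj a).obj _) k :
    (((H.comp G).comp K).prof.obj a).obj d))
    (fun c c' g x k => by rw [← map_pair, pair_sound]) w

theorem assocInvFun_pair {a : A} {d : Dᵒᵖ} (b : B) (c : C) (h : (H.prof.obj a).obj (op b))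
    (x : (G.prof.obj b).obj (op c)) (k : (K.prof.obj c).obj d) :
    assocInvFun H G K b h (pair c x k) = pair c (pair b h x) k :=
  pairLift_pair _ _ c x k

/-- The associator, `pair c (pair b h x) k ↦ pair b h (pair c x k)`. -/
def assocHom : (H.comp G).comp K ⟶ H.comp (G.comp K) :=
  homMk (H := H.comp G) (G := K) (fun c z k => assocFun H G K c z k)
    (fun {a d} c c' g z k => by
      induction z using pair_ind with | w b h x
      rw [map_pair, assocFun_pair, assocFun_pair, pair_sound])
    (fun f c z k => by
      induction z using pair_ind with | w b h x
      rw [assocFun_pair, assocFun_pair, map_pair, map_pair])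
    (fun f c z k => by
      induction z using pair_ind with | w b h x
      rw [map_app_pair, assocFun_pair, assocFun_pair, map_app_pair])

theorem ap_assocHom {a : A} {d : Dᵒᵖ} (b : B) (c : C) (h : (H.prof.obj a).obj (op b))
    (x : (G.prof.obj b).obj (op c)) (k : (K.prof.obj c).obj d) :
    Hom.ap (assocHom H G K)
      (pair c (pair b h x : ((H.comp G).prof.obj a).obj _) k :
        (((H.comp G).comp K).prof.obj a).obj d) = pair b h (pair c x k) :=
  (ap_homMk _ _ _ _ _ _ _).trans (assocFun_pair H G K b c h x k)

/-- The inverse of the associator. -/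
def assocInv : H.comp (G.comp K) ⟶ (H.comp G).comp K :=
  homMk (H := H) (G := G.comp K) (fun b h w => assocInvFun H G K b h w)
    (fun {a d} b b' g h w => by
      induction w using pair_ind with | w c x k
      rw [map_app_pair, assocInvFun_pair, assocInvFun_pair, pair_sound])
    (fun f b h w => by
      induction w using pair_ind with | w c x k
      rw [map_pair, assocInvFun_pair, assocInvFun_pair, map_pair])
    (fun f b h w => by
      induction w using pair_ind with | w c x k
      rw [assocInvFun_pair, assocInvFun_pair, map_app_pair, map_app_pair])

theorem ap_assocInv {a : A} {d : Dᵒᵖ} (b : B) (c : C) (h : (H.prof.obj a).obj (op b))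
    (x : (G.prof.obj b).obj (op c)) (k : (K.prof.obj c).obj d) :
    Hom.ap (assocInv H G K)
      (pair b h (pair c x k : ((G.comp K).prof.obj b).obj d) :
        ((H.comp (G.comp K)).prof.obj a).obj d) = pair c (pair b h x) k :=
  (ap_homMk _ _ _ _ _ _ _).trans (assocInvFun_pair H G K b c h x k)

/-- The associator of profunctors. -/
def assoc : (H.comp G).comp K ≅ H.comp (G.comp K) :=
  isoMk (assocHom H G K) (assocInv H G K)
    (fun {a d} z => by
      induction z using pair_ind with | w c z k
      induction z using pair_ind with | w b h x
      rw [ap_assocHom, ap_assocInv])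
    (fun {a d} z => by
      induction z using pair_ind with | w b h z
      induction z using pair_ind with | w c x k
      rw [ap_assocInv, ap_assocHom])

end Associator

section Unitors

variable (H : SmallProfunctor A B)

/-- The left unitor, `pair a f h ↦ H(-, f) h`. -/
def leftUnitorHom : (id A).comp H ⟶ H :=
  homMk (H := id A) (G := H) (fun {a b} a' (f : a' ⟶ a) h => (H.prof.map f).app b h)
    (fun {a b} a' a'' g (f : a'' ⟶ a) h =>
      congrArg (fun (t : H.prof.obj a' ⟶ H.prof.obj a) => t.app b h) (H.prof.map_comp g f))
    (fun f _ (g : _ ⟶ _) h => NatTrans.naturality_apply (H.prof.map g) f h)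
    (fun {a a' b} f a'' (g : a'' ⟶ a) h =>
      congrArg (fun (t : H.prof.obj a'' ⟶ H.prof.obj a') => t.app b h) (H.prof.map_comp g f))

theorem ap_leftUnitorHom {a : A} {b : Bᵒᵖ} (a' : A) (f : ((id A).prof.obj a).obj (op a'))
    (h : (H.prof.obj a').obj b) :
    Hom.ap (leftUnitorHom H) (pair a' f h) = (H.prof.map (f : a' ⟶ a)).app b h :=
  ap_homMk _ _ _ _ _ _ _

/-- The inverse of the left unitor, `h ↦ pair a 𝟙 h`. -/
def leftUnitorInv : H ⟶ (id A).comp H where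
  hom :=
    { app := fun a =>
        { app := fun b => ↾(fun h => pair (H := id A) (G := H) a (𝟙 a) h)
          naturality := fun b b' f => by
            ext h
            exact (map_pair (H := id A) (G := H) f a (𝟙 a) h).symm }
      naturality := fun a a' f => by
        ext b h
        have h₁ : (id A).prof.map f = yoneda.map f := rfl
        refine Eq.trans ?_ (map_app_pair (H := id A) (G := H) f a (𝟙 a) h).symm
        refine (pair_sound (H := id A) (G := H) f (𝟙 a') h).symm.trans ?_
        exact congrArg (fun (t : a ⟶ a') => (pair (H := id A) (G := H) a t h))
          ((Category.comp_id f).trans (Category.id_comp f).symm) }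

theorem ap_leftUnitorInv {a : A} {b : Bᵒᵖ} (h : (H.prof.obj a).obj b) :
    Hom.ap (leftUnitorInv H) h = pair (H := id A) (G := H) a (𝟙 a) h := rfl

/-- The left unitor. -/
def leftUnitor : (id A).comp H ≅ H :=
  isoMk (leftUnitorHom H) (leftUnitorInv H)
    (fun {a b} z => by
      induction z using pair_ind with | w a' f h
      rw [ap_leftUnitorHom, ap_leftUnitorInv]
      refine (pair_sound (H := id A) (G := H) f (𝟙 a) h).symm.trans ?_
      exact congrArg (fun (t : a' ⟶ a) => (pair (H := id A) (G := H) a' t h))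
        (Category.comp_id f))
    (fun {a b} h => by
      refine (ap_leftUnitorHom H a (𝟙 a) h).trans ?_
      rw [H.prof.map_id]
      rfl)

/-- The right unitor, `pair b h f ↦ H(f, -) h`. -/
def rightUnitorHom : H.comp (id B) ⟶ H :=
  homMk (H := H) (G := id B) (fun {a b} b' h (f : b.unop ⟶ b') => (H.prof.obj a).map f.op h)
    (fun {a b} b' _ g h (f : b.unop ⟶ b') =>
      (Functor.map_comp_apply (H.prof.obj a) g.op f.op h).symm)
    (fun {a b _} f _ h (g : b.unop ⟶ _) => Functor.map_comp_apply (H.prof.obj a) g.op f h)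
    (fun {_ _ b} f _ h (g : b.unop ⟶ _) =>
      (NatTrans.naturality_apply (H.prof.map f) g.op h).symm)

theorem ap_rightUnitorHom {a : A} {b : Bᵒᵖ} (b' : B) (h : (H.prof.obj a).obj (op b'))
    (f : ((id B).prof.obj b').obj b) :
    Hom.ap (rightUnitorHom H) (pair b' h f) = (H.prof.obj a).map (f : b.unop ⟶ b').op h :=
  ap_homMk _ _ _ _ _ _ _

/-- The inverse of the right unitor, `h ↦ pair b h 𝟙`. -/
def rightUnitorInv : H ⟶ H.comp (id B) where
  hom :=
    { app := fun a =>
        { app := fun b => ↾(fun h => pair (H := H) (G := id B) b.unop h (𝟙 b.unop))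
          naturality := fun b b' f => by
            ext h
            refine Eq.trans ?_ (map_pair (H := H) (G := id B) f b.unop h (𝟙 b.unop)).symm
            refine (pair_sound (H := H) (G := id B) f.unop h (𝟙 b'.unop)).trans ?_
            exact congrArg (fun (t : b'.unop ⟶ b.unop) => (pair (H := H) (G := id B) b.unop h t))
              ((Category.id_comp f.unop).trans (Category.comp_id f.unop).symm) }
      naturality := fun a a' f => by
        ext b h
        exact (map_app_pair (H := H) (G := id B) f b.unop h (𝟙 b.unop)).symm }

theorem ap_rightUnitorInv {a : A} {b : Bᵒᵖ} (h : (H.prof.obj a).obj b) :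
    Hom.ap (rightUnitorInv H) h = pair (H := H) (G := id B) b.unop h (𝟙 b.unop) := rfl

/-- The right unitor. -/
def rightUnitor : H.comp (id B) ≅ H :=
  isoMk (rightUnitorHom H) (rightUnitorInv H)
    (fun {a b} z => by
      induction z using pair_ind with | w b' h f
      rw [ap_rightUnitorHom, ap_rightUnitorInv]
      refine (pair_sound (H := H) (G := id B) (f : b.unop ⟶ b') h (𝟙 b.unop)).trans ?_
      exact congrArg (fun (t : b.unop ⟶ b') => (pair (H := H) (G := id B) b' h t))
        (Category.id_comp f))
    (fun {a b} h => by
      refine (ap_rightUnitorHom H b.unop h (𝟙 b.unop)).trans ?_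
      exact Functor.map_id_apply (H.prof.obj a) _ h)

end Unitors

section Laws

variable {E : Type (u + 1)} [Category.{u} E]

theorem whiskerLeft_id (H : SmallProfunctor A B) (G : SmallProfunctor B C) :
    whiskerLeft H (𝟙 G) = 𝟙 (H.comp G) :=
  hom_ext_pair fun b h x => by rw [ap_whiskerLeft, ap_id, ap_id]

theorem whiskerLeft_comp (H : SmallProfunctor A B) {G G' G'' : SmallProfunctor B C}
    (τ : G ⟶ G') (τ' : G' ⟶ G'') :
    whiskerLeft H (τ ≫ τ') = whiskerLeft H τ ≫ whiskerLeft H τ' :=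
  hom_ext_pair fun b h x => by
    rw [ap_whiskerLeft, ap_comp, ap_comp, ap_whiskerLeft, ap_whiskerLeft]

theorem id_whiskerRight (H : SmallProfunctor A B) (G : SmallProfunctor B C) :
    whiskerRight (𝟙 H) G = 𝟙 (H.comp G) :=
  hom_ext_pair fun b h x => by rw [ap_whiskerRight, ap_id, ap_id]

theorem comp_whiskerRight {H H' H'' : SmallProfunctor A B} (σ : H ⟶ H') (σ' : H' ⟶ H'')
    (G : SmallProfunctor B C) :
    whiskerRight (σ ≫ σ') G = whiskerRight σ G ≫ whiskerRight σ' G :=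
  hom_ext_pair fun b h x => by
    rw [ap_whiskerRight, ap_comp, ap_comp, ap_whiskerRight, ap_whiskerRight]

theorem whisker_exchange {H H' : SmallProfunctor A B} {G G' : SmallProfunctor B C} (σ : H ⟶ H')
    (τ : G ⟶ G') :
    whiskerLeft H τ ≫ whiskerRight σ G' = whiskerRight σ G ≫ whiskerLeft H' τ :=
  hom_ext_pair fun b h x => by
    rw [ap_comp, ap_comp, ap_whiskerLeft, ap_whiskerRight, ap_whiskerRight, ap_whiskerLeft]

theorem id_whiskerLeft {H G : SmallProfunctor A B} (σ : H ⟶ G) :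
    whiskerLeft (id A) σ = (leftUnitor H).hom ≫ σ ≫ (leftUnitor G).inv := by
  rw [← Category.assoc, Iso.eq_comp_inv]
  refine hom_ext_pair fun a f h => ?_
  rw [ap_comp, ap_comp, ap_whiskerLeft]
  refine (ap_leftUnitorHom G a f _).trans ?_
  refine Eq.trans ?_ (congrArg (Hom.ap σ) (ap_leftUnitorHom H a f h)).symm
  exact (ap_app σ _ h).symm

theorem whiskerRight_id {H G : SmallProfunctor A B} (σ : H ⟶ G) :
    whiskerRight σ (id B) = (rightUnitor H).hom ≫ σ ≫ (rightUnitor G).inv := by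
  rw [← Category.assoc, Iso.eq_comp_inv]
  refine hom_ext_pair fun b h f => ?_
  rw [ap_comp, ap_comp, ap_whiskerRight]
  refine (ap_rightUnitorHom G b _ f).trans ?_
  refine Eq.trans ?_ (congrArg (Hom.ap σ) (ap_rightUnitorHom H b h f)).symm
  exact (ap_map σ _ h).symm

theorem comp_whiskerLeft (H : SmallProfunctor A B) (G : SmallProfunctor B C)
    {K K' : SmallProfunctor C D} (τ : K ⟶ K') :
    whiskerLeft (H.comp G) τ =
      (assoc H G K).hom ≫ whiskerLeft H (whiskerLeft G τ) ≫ (assoc H G K').inv := by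
  rw [← Category.assoc, Iso.eq_comp_inv]
  refine hom_ext_pair fun c z k => ?_
  induction z using pair_ind with | w b h x
  rw [ap_comp, ap_comp, ap_whiskerLeft]
  refine (ap_assocHom H G K' b c h x _).trans ?_
  refine Eq.trans ?_ (congrArg (Hom.ap _) (ap_assocHom H G K b c h x k)).symm
  rw [ap_whiskerLeft, ap_whiskerLeft]

theorem whiskerRight_comp {H H' : SmallProfunctor A B} (σ : H ⟶ H') (G : SmallProfunctor B C)
    (K : SmallProfunctor C D) :
    whiskerRight σ (G.comp K) =
      (assoc H G K).inv ≫ whiskerRight (whiskerRight σ G) K ≫ (assoc H' G K).hom := by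
  rw [Iso.eq_inv_comp]
  refine hom_ext_pair fun c z k => ?_
  induction z using pair_ind with | w b h x
  rw [ap_comp, ap_comp, ap_whiskerRight, ap_whiskerRight]
  refine Eq.trans ?_ (ap_assocHom H' G K b c _ x k).symm
  refine (congrArg (Hom.ap _) (ap_assocHom H G K b c h x k)).trans ?_
  rw [ap_whiskerRight]

theorem whisker_assoc (H : SmallProfunctor A B) {G G' : SmallProfunctor B C} (τ : G ⟶ G')
    (K : SmallProfunctor C D) :
    whiskerRight (whiskerLeft H τ) K =
      (assoc H G K).hom ≫ whiskerLeft H (whiskerRight τ K) ≫ (assoc H G' K).inv := by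
  rw [← Category.assoc, Iso.eq_comp_inv]
  refine hom_ext_pair fun c z k => ?_
  induction z using pair_ind with | w b h x
  rw [ap_comp, ap_comp, ap_whiskerRight, ap_whiskerLeft]
  refine (ap_assocHom H G' K b c h _ k).trans ?_
  refine Eq.trans ?_ (congrArg (Hom.ap _) (ap_assocHom H G K b c h x k)).symm
  rw [ap_whiskerLeft, ap_whiskerRight]

theorem pentagon (H : SmallProfunctor A B) (G : SmallProfunctor B C) (K : SmallProfunctor C D)
    (L : SmallProfunctor D E) :
    whiskerRight (assoc H G K).hom L ≫ (assoc H (G.comp K) L).hom ≫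
        whiskerLeft H (assoc G K L).hom =
      (assoc (H.comp G) K L).hom ≫ (assoc H G (K.comp L)).hom := by
  refine hom_ext_pair fun d z l => ?_
  induction z using pair_ind with | w c z k
  induction z using pair_ind with | w b h x
  rw [ap_comp, ap_comp, ap_comp, ap_whiskerRight]
  refine Eq.trans (congrArg (fun t => Hom.ap _ (Hom.ap _ (pair d t l)))
    (ap_assocHom H G K b c h x k)) ?_
  refine Eq.trans (congrArg (Hom.ap _) (ap_assocHom H (G.comp K) L b d h _ l)) ?_
  rw [ap_whiskerLeft]
  refine Eq.trans (congrArg (pair b h) (ap_assocHom G K L c d x k l)) ?_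
  refine Eq.symm ((congrArg (Hom.ap _) (ap_assocHom (H.comp G) K L c d _ k l)).trans ?_)
  exact ap_assocHom H G (K.comp L) b c h x _

theorem triangle (H : SmallProfunctor A B) (G : SmallProfunctor B C) :
    (assoc H (id B) G).hom ≫ whiskerLeft H (leftUnitor G).hom =
      whiskerRight (rightUnitor H).hom G := by
  refine hom_ext_pair fun b z x => ?_
  induction z using pair_ind with | w b' h f
  rw [ap_comp, ap_whiskerRight]
  refine (congrArg (Hom.ap _) (ap_assocHom H (id B) G b' b h f x)).trans ?_
  rw [ap_whiskerLeft]
  refine (congrArg (pair b' h) (ap_leftUnitorHom G b f x)).trans ?_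
  refine (pair_sound _ h x).symm.trans ?_
  exact congrArg (fun t => pair b t x) (ap_rightUnitorHom H b' h f).symm

end Laws

end SmallProfunctor

/-- The bicategory of locally small categories, small profunctors and natural transformations. -/
structure Prof : Type (u + 2) where
  /-- The underlying category. -/
  cat : Cat.{u, u + 1}

namespace Prof

open SmallProfunctor

instance : Bicategory Prof.{u} where
  Hom A B := SmallProfunctor A.cat B.cat
  id A := SmallProfunctor.id A.cat
  comp H G := H.comp G
  homCategory A B := inferInstanceAs (Category (SmallProfunctor A.cat B.cat))
  whiskerLeft H _ _ τ := whiskerLeft H τ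
  whiskerRight σ G := whiskerRight σ G
  associator H G K := assoc H G K
  leftUnitor H := leftUnitor H
  rightUnitor H := rightUnitor H
  whiskerLeft_id H G := SmallProfunctor.whiskerLeft_id H G
  whiskerLeft_comp H _ _ _ τ τ' := SmallProfunctor.whiskerLeft_comp H τ τ'
  id_whiskerLeft σ := SmallProfunctor.id_whiskerLeft σ
  comp_whiskerLeft H G _ _ τ := SmallProfunctor.comp_whiskerLeft H G τ
  id_whiskerRight H G := SmallProfunctor.id_whiskerRight H G
  comp_whiskerRight σ σ' G := SmallProfunctor.comp_whiskerRight σ σ' G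
  whiskerRight_id σ := SmallProfunctor.whiskerRight_id σ
  whiskerRight_comp σ G K := SmallProfunctor.whiskerRight_comp σ G K
  whisker_assoc H _ _ τ K := SmallProfunctor.whisker_assoc H τ K
  whisker_exchange σ τ := SmallProfunctor.whisker_exchange σ τ
  pentagon H G K L := SmallProfunctor.pentagon H G K L
  triangle H G := SmallProfunctor.triangle H G

end Prof

end

end ReflLimit

universe w₁ v₁ u₁ w₂ v₂ u₂ v₃ u₃ u

/-! Composites below are in diagrammatic order.

Kleisli 2-category. Let `(L, c)` be a bilimit in `K` of the underlying diagram. Restriction along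
the unit identifies the Kleisli 1-cells `DA ⟶ DB` with the 1-cells `A ⟶ DB` of `K`, because
pseudomorphisms are left Kan extended along `y`. In the same way, cones in the Kleisli 2-category
with vertex `DA` correspond to cones in `K` with vertex `A`. So `c` extends to a cone `μ` with
vertex `DL`, and `μ` is the candidate. The bilimit property at `DL` yields `r : DL ⟶ L` such that
`c` restricted along `r` is `μ`. As `μ` restricts along `y` to `c`, there is an isomorphism `y ≫ r ≅
𝟙`. It is the counit of an adjunction `r ⊣ y` (`exists_adjunction`). The triangle identity at `r`
requires 2-cells out of `r` to be detected along `y`; this holds because the comparison functor of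
`c` is faithful and `r` followed by any leg of `c` is isomorphic to a pseudomorphism. After
restriction along the unit, the comparison functor of `μ` at `DA` becomes postcomposition with `r`,
from `K(A, DL)` to `K(A, L)`, followed by the comparison functor of `c`. The first is left adjoint
to postcomposition with `y`, with invertible counit, and the second is an equivalence; hence the
composite is a reflector. The argument is carried out in `isReflectorLimit_of_isBilimit`.

Small profunctors. The vertex is the category of cones whose vertex is the terminal category. It is
locally small because maps out of a small presheaf form a small set. Its universal cone sends a cone
`l` to the presheaves that constitute `l`. A cone `c` with vertex `A` evaluates to a functor from
`A` to this category, and the right adjoint of the comparison sends `c` to the profunctor that this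
functor represents (`classifier`). The counit is invertible by the co-Yoneda lemma
(`isIso_counitHom`). By the universal property of the coend, transformations from `H` into the
classifier are the same as morphisms of cones from the comparison at `H` to `c` (`classify`). -/

namespace ReflLimit

/-! ### Functors that are bijective on morphisms into an object -/

section Reflectors

variable {C : Type u₁} [Category.{v₁} C] {E : Type u₂} [Category.{v₂} E] {E' : Type u₃}
  [Category.{v₃} E']

/-- A functor with invertible universal arrows `F g ≅ e` for all `e` is a reflector. -/
theorem isReflector_of_universal (F : C ⥤ E)
    (H : ∀ e : E, ∃ (g : C) (i : F.obj g ≅ e),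
      ∀ X : C, Function.Bijective (fun τ : X ⟶ g => F.map τ ≫ i.hom)) : IsReflector F := by
  choose g i hb using H
  let adj := Adjunction.adjunctionOfEquivRight (F := F) (G_obj := g)
    (he := fun X' X e f h => by
      obtain ⟨k, rfl⟩ := (hb e X).2 h
      rw [Equiv.symm_apply_eq]
      have : (Equiv.ofBijective _ (hb e X)).symm (F.map k ≫ (i e).hom) = k :=
        (Equiv.ofBijective _ (hb e X)).symm_apply_apply k
      rw [this]
      simp) (fun X e => (Equiv.ofBijective _ (hb e X)).symm)
  have : ∀ e, IsIso (adj.counit.app e) := fun e => by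
    -- The counit corresponds to the identity of `g e` under the hom-bijection, so it is the given
    -- isomorphism up to `F.map (𝟙 _)`.
    have h : adj.counit.app e = F.map (𝟙 (g e)) ≫ (i e).hom := by
      simp [adj, Adjunction.adjunctionOfEquivRight]
    rw [h]
    infer_instance
  exact ⟨_, adj, NatIso.isIso_of_isIso_app _⟩

/-- `F` is bijective on morphisms with codomain `q`. -/
def BijectiveInto (F : C ⥤ E) (q : C) : Prop :=
  ∀ p : C, Function.Bijective (fun τ : p ⟶ q => F.map τ)

/-- Bijectivity into `g` makes any isomorphism from the image of `g` to `e` a universal arrow.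
Unlike the universal arrow itself, `BijectiveInto` passes easily through natural isomorphisms and
fully faithful functors, which is how the Kleisli comparison is treated. -/
theorem isReflector_of_bijectiveInto (F : C ⥤ E)
    (H : ∀ e : E, ∃ g : C, Nonempty (F.obj g ≅ e) ∧ BijectiveInto F g) : IsReflector F :=
  isReflector_of_universal F fun e => by
    obtain ⟨g, ⟨i⟩, hb⟩ := H e
    refine ⟨g, i, fun X => ?_⟩
    convert ((Iso.refl (F.obj X)).homCongr i).bijective.comp (hb X) using 1
    funext τ
    simp

theorem BijectiveInto.of_iso {F : C ⥤ E} {q q' : C} (i : q ≅ q') (h : BijectiveInto F q) :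
    BijectiveInto F q' := fun p => by
  have := ((Iso.refl (F.obj p)).homCongr (F.mapIso i)).bijective.comp
    ((h p).comp ((Iso.refl p).homCongr i.symm).bijective)
  convert this using 1
  funext τ
  simp only [Function.comp_apply, Iso.homCongr_apply, Iso.refl_inv, Iso.symm_hom,
    Functor.mapIso_hom, Category.id_comp, ← F.map_comp, Category.assoc, Iso.inv_hom_id,
    Category.comp_id]

theorem BijectiveInto.of_natIso {F F' : C ⥤ E} (i : F ≅ F') {q : C} (h : BijectiveInto F q) :
    BijectiveInto F' q := fun p => by
  have := ((i.app p).homCongr (i.app q)).bijective.comp (h p)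
  convert this using 1
  funext τ
  simp

theorem BijectiveInto.of_comp {F : C ⥤ E} {G : E ⥤ E'} [G.Faithful] [G.Full] {q : C}
    (h : BijectiveInto (F ⋙ G) q) : BijectiveInto F q := fun p => by
  refine (Function.Bijective.of_comp_iff' (f := fun τ => G.map τ)
    ⟨G.map_injective, G.map_surjective⟩ _).1 (h p)

theorem BijectiveInto.comp {F : C ⥤ E} {G : E ⥤ E'} [F.Faithful] [F.Full] {q : C}
    (h : BijectiveInto G (F.obj q)) : BijectiveInto (F ⋙ G) q := fun p =>
  (h (F.obj p)).comp ⟨F.map_injective, F.map_surjective⟩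

theorem BijectiveInto.comp_right {F : C ⥤ E} {G : E ⥤ E'} [G.Faithful] [G.Full] {q : C}
    (h : BijectiveInto F q) : BijectiveInto (F ⋙ G) q := fun p =>
  Function.Bijective.comp (g := fun τ => G.map τ) ⟨G.map_injective, G.map_surjective⟩ (h p)

end Reflectors

/-! ### Postcomposition with a reflection in a bicategory. -/

section Adjunctions

variable {K : Type u₁} [Bicategory.{w₁, v₁} K] {a b c : K} {r : a ⟶ b} {y : b ⟶ a}

/-- If `r ⊣ y` with invertible counit then postcomposition with `r` is bijective on 2-cells into
1-cells that factor through `y`. -/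
theorem bijectiveInto_postcomp (adj : Bicategory.Adjunction r y) [IsIso adj.counit] (t : c ⟶ b) :
    BijectiveInto (postcomp c r) (t ≫ y) := fun p => by
  let A : postcomp c r ⊣ postcomp c y := Adjunction.mkOfUnitCounit
    { unit :=
        { app := fun p => (ρ_ p).inv ≫ p ◁ adj.unit ≫ (α_ _ _ _).inv
          naturality := fun p p' s => by
            dsimp [postcomp]
            rw [rightUnitor_inv_naturality_assoc, ← whisker_exchange_assoc]
            simp }
      counit :=
        { app := fun p => (α_ _ _ _).hom ≫ p ◁ adj.counit ≫ (ρ_ p).hom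
          naturality := fun p p' s => by
            dsimp [postcomp]
            rw [Category.assoc, Category.assoc, ← rightUnitor_naturality, whisker_exchange_assoc]
            simp }
      left_triangle := by
        ext p
        dsimp [postcomp]
        calc
          _ = 𝟙 _ ⊗≫ p ◁ leftZigzag adj.unit adj.counit ⊗≫ 𝟙 _ := by
            dsimp [leftZigzag]; bicategory
          _ = _ := by rw [adj.left_triangle]; bicategory
      right_triangle := by
        ext p
        dsimp [postcomp]
        calc
          _ = 𝟙 _ ⊗≫ p ◁ rightZigzag adj.unit adj.counit ⊗≫ 𝟙 _ := by
            dsimp [rightZigzag]; bicategory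
          _ = _ := by rw [adj.right_triangle]; bicategory }
  have hi : IsIso (A.counit.app t) := by
    change IsIso ((α_ _ _ _).hom ≫ t ◁ adj.counit ≫ (ρ_ t).hom)
    infer_instance
  have h1 := (A.homEquiv p t).symm.bijective
  have h2 := ((Iso.refl ((postcomp c r).obj p)).homCongr (asIso (A.counit.app t)).symm).bijective
  -- The hom-bijection of the adjunction sends `τ` to its image followed by the counit at `t`.
  -- Cancelling this invertible counit leaves the image alone.
  have key : ∀ τ : p ⟶ (postcomp c y).obj t,
      (Iso.refl ((postcomp c r).obj p)).homCongr (asIso (A.counit.app t)).symm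
        ((A.homEquiv p t).symm τ) = (postcomp c r).map τ := fun τ => by
    rw [A.homEquiv_counit, Iso.homCongr_apply, Iso.refl_inv, Category.id_comp, Category.assoc]
    exact (congrArg _ (IsIso.hom_inv_id (A.counit.app t))).trans (Category.comp_id _)
  exact (congrArg Function.Bijective (funext key)).mp (h2.comp h1)

end Adjunctions

end ReflLimit

namespace ReflLimit

/-! ### Functoriality of the restriction of cones -/

namespace WCone

variable {J : Type u₂} [Bicategory.{w₂, v₂} J] {K : Type u₁} [Bicategory.{w₁, v₁} K]
  {W : J ⥤ᵖ Cat.{v₃, u₃}} {F : J ⥤ᵖ K}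

/-- An isomorphism of cones from a family of isomorphisms of the components. -/
def isoMk {A : K} {c d : WCone W F A} (i : ∀ j, c.app j ≅ d.app j)
    (comm : ∀ {j k : J} (f : j ⟶ k) (x : W.obj j),
      (i k).hom.app ((W.map f).toFunctor.obj x) ≫ (d.nat f x).hom =
        (c.nat f x).hom ≫ (i j).hom.app x ▷ F.map f) : c ≅ d where
  hom := { app := fun j => (i j).hom, comm := comm }
  inv :=
    { app := fun j => (i j).inv
      comm := fun {j k} f x => by
        have h := comm f x
        rw [← cancel_epi ((i k).hom.app ((W.map f).toFunctor.obj x)), ← Category.assoc,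
          ← NatTrans.comp_app, Iso.hom_inv_id, ← Category.assoc, h, Category.assoc,
          ← comp_whiskerRight, ← NatTrans.comp_app, Iso.hom_inv_id]
        simp }
  hom_inv_id := by ext j : 1; exact (i j).hom_inv_id
  inv_hom_id := by ext j : 1; exact (i j).inv_hom_id

/-- Restriction of cones along a 1-cell, as a functor. -/
@[reducible]
def restrictFunctor {A L : K} (θ : A ⟶ L) : WCone W F L ⥤ WCone W F A where
  obj c := c.restrict θ
  map {c d} s :=
    { app := fun j =>
        { app := fun x => θ ◁ (s.app j).app x
          naturality := fun x y p => by
            dsimp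
            rw [← Bicategory.whiskerLeft_comp, ← Bicategory.whiskerLeft_comp,
              (s.app j).naturality] }
      comm := fun {i j} f x => by
        have h := s.comm f x
        simp only [Iso.trans_hom, whiskerLeftIso_hom, Iso.symm_hom, Category.assoc]
        rw [← Bicategory.whiskerLeft_comp_assoc, h]
        simp }

/-- Restriction along a composite. -/
def restrictComp {A B L : K} (c : WCone W F L) (θ : A ⟶ B) (φ : B ⟶ L) :
    c.restrict (θ ≫ φ) ≅ (c.restrict φ).restrict θ :=
  isoMk (fun j => NatIso.ofComponents (fun x => α_ θ φ ((c.app j).obj x))) (by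
    intros
    simp)

/-- Restriction along an identity. -/
def restrictId {L : K} (c : WCone W F L) : c.restrict (𝟙 L) ≅ c :=
  isoMk (fun j => NatIso.ofComponents (fun x => λ_ ((c.app j).obj x))) (by
    intros
    simp)

/-- The comparison functor of a restricted cone. -/
def comparisonRestrict {B L : K} (c : WCone W F L) (φ : B ⟶ L) (A : K) :
    postcomp A φ ⋙ c.comparison A ≅ (c.restrict φ).comparison A :=
  NatIso.ofComponents (fun θ => c.restrictComp θ φ) (fun τ => by
    ext j x
    exact (associator_naturality_left τ φ ((c.app j).obj x) :))

/-- Isomorphic cones have isomorphic comparison functors. -/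
def comparisonIso {L : K} {c d : WCone W F L} (i : c ≅ d) (A : K) :
    c.comparison A ≅ d.comparison A :=
  NatIso.ofComponents (fun θ => (restrictFunctor θ).mapIso i) (fun τ => by
    ext j x
    exact (whisker_exchange τ ((i.hom.app j).app x)).symm)

end WCone

end ReflLimit

namespace ReflLimit

/-! ### Cones in the Kleisli 2-category -/

/-! ### Transport of the cone axioms along isomorphisms. -/

section Conjugation

variable {K : Type u₁} [Bicategory.{w₁, v₁} K] {a b c d e : K} {y : a ⟶ b}

/-- An extension `m` of `q` along `y` is known only through an isomorphism `y ≫ m ≅ q`. A cone axiom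
for extensions, whiskered with `y`, is therefore the axiom for the original 1-cells conjugated by
such isomorphisms: the inner ones cancel and `h` applies. This lemma and the next three treat one
cone axiom each. -/
theorem conj_nat_naturality {m m' : b ⟶ c} {n n' : b ⟶ d} {q q' : a ⟶ c} {r r' : a ⟶ d}
    {F : c ⟶ d} (i : y ≫ m ≅ q) (i' : y ≫ m' ≅ q') (l : y ≫ n ≅ r) (l' : y ≫ n' ≅ r')
    (p : q ⟶ q') (s : r ⟶ r') (t : r ⟶ q ≫ F) (t' : r' ⟶ q' ≫ F) (h : s ≫ t' = t ≫ p ▷ F) :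
    (l.hom ≫ s ≫ l'.inv) ≫ l'.hom ≫ t' ≫ i'.inv ▷ F ≫ (α_ y m' F).hom =
      (l.hom ≫ t ≫ i.inv ▷ F ≫ (α_ y m F).hom) ≫ (α_ y m F).inv ≫
        (i.hom ≫ p ≫ i'.inv) ▷ F ≫ (α_ y m' F).hom := by
  simp [reassoc_of% h]

theorem conj_nat_map₂ {m : b ⟶ c} {n n' : b ⟶ d} {q : a ⟶ c} {r r' : a ⟶ d}
    {F F' : c ⟶ d} (i : y ≫ m ≅ q) (l : y ≫ n ≅ r) (l' : y ≫ n' ≅ r')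
    (s : r ⟶ r') (t : r ⟶ q ≫ F) (t' : r' ⟶ q ≫ F') (p : F ⟶ F') (h : s ≫ t' = t ≫ q ◁ p) :
    (l.hom ≫ s ≫ l'.inv) ≫ l'.hom ≫ t' ≫ i.inv ▷ F' ≫ (α_ y m F').hom =
      (l.hom ≫ t ≫ i.inv ▷ F ≫ (α_ y m F).hom) ≫ (α_ y m F).inv ≫
        (y ≫ m) ◁ p ≫ (α_ y m F').hom := by
  simp only [Category.assoc, Iso.inv_hom_id_assoc, Iso.hom_inv_id_assoc, reassoc_of% h,
    whisker_exchange_assoc]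

theorem conj_nat_id {m n : b ⟶ c} {q r : a ⟶ c} {F : c ⟶ c} (i : y ≫ m ≅ q) (l : y ≫ n ≅ r)
    (s : r ⟶ q) (t : r ⟶ q ≫ F) (p : F ⟶ 𝟙 c) (h : t ≫ q ◁ p = s ≫ (ρ_ q).inv) :
    (l.hom ≫ t ≫ i.inv ▷ F ≫ (α_ y m F).hom) ≫ (α_ y m F).inv ≫
        (y ≫ m) ◁ p ≫ (α_ y m (𝟙 c)).hom =
      (l.hom ≫ s ≫ i.inv) ≫ y ◁ (ρ_ m).inv := by
  simp only [Category.assoc, Iso.hom_inv_id_assoc, ← whisker_exchange_assoc, reassoc_of% h]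
  simp

theorem conj_nat_comp {m : b ⟶ c} {n : b ⟶ d} {k k' : b ⟶ e} {q : a ⟶ c} {r : a ⟶ d}
    {v v' : a ⟶ e} {F : c ⟶ d} {G : d ⟶ e} {H : c ⟶ e} (i : y ≫ m ≅ q) (l : y ≫ n ≅ r)
    (o : y ≫ k ≅ v) (o' : y ≫ k' ≅ v') (s : v ⟶ v') (t : v ⟶ q ≫ H) (t' : v' ⟶ r ≫ G)
    (t'' : r ⟶ q ≫ F) (p : H ⟶ F ≫ G)
    (h : t ≫ q ◁ p = s ≫ t' ≫ t'' ▷ G ≫ (α_ q F G).hom) :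
    (o.hom ≫ t ≫ i.inv ▷ H ≫ (α_ y m H).hom) ≫ (α_ y m H).inv ≫
        (y ≫ m) ◁ p ≫ (α_ y m (F ≫ G)).hom =
      (o.hom ≫ s ≫ o'.inv) ≫ (o'.hom ≫ t' ≫ l.inv ▷ G ≫ (α_ y n G).hom) ≫
        ((α_ y n G).inv ≫ (l.hom ≫ t'' ≫ i.inv ▷ F ≫ (α_ y m F).hom) ▷ G ≫
          (α_ y (m ≫ F) G).hom) ≫ y ◁ (α_ m F G).hom := by
  simp only [Category.assoc, Iso.hom_inv_id_assoc, ← whisker_exchange_assoc, reassoc_of% h]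
  simp

/-- The same cancellation, used to see that the conjugating isomorphisms themselves form an
isomorphism of cones. -/
theorem conj_nat_isoMk {m : b ⟶ c} {n : b ⟶ d} {q : a ⟶ c} {r : a ⟶ d} {F : c ⟶ d}
    (i : y ≫ m ≅ q) (l : y ≫ n ≅ r) (t : r ⟶ q ≫ F) :
    l.hom ≫ t =
      ((l.hom ≫ t ≫ i.inv ▷ F ≫ (α_ y m F).hom) ≫ (α_ y m F).inv) ≫ i.hom ▷ F := by
  simp

end Conjugation

/-! ### Restriction along the unit, for Kleisli 1-cells and for cones. -/

section Kleisli

variable {K : Type u₁} [Bicategory.{w₁, v₁} K] {D : LeftKanPseudomonad K}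

/-- 2-cells out of a pseudomorphism are determined by their restriction along the unit. -/
theorem LeftKanPseudomonad.IsPseudomorphism.bijective_whiskerLeft {A B : K}
    {h : D.obj A ⟶ D.obj B} (hh : D.IsPseudomorphism h) (k : D.obj A ⟶ D.obj B) :
    Function.Bijective (fun τ : h ⟶ k => D.y A ◁ τ) := by
  obtain ⟨H⟩ := hh (D.y A)
  obtain ⟨H₁⟩ := D.ext_isKan (D.y A)
  obtain ⟨H₂⟩ := D.id_isKan A
  -- The chosen extension of `y` along itself, which `h` preserves, is isomorphic to the identity
  -- with its unitor. Hence `𝟙 ≫ h` is a left Kan extension of `y ≫ h` along `y`, and its universal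
  -- property is the claim up to `λ_ h`.
  have H₃ := (isKan_iff _).1
    ⟨LeftExtension.IsKan.whiskerOfCommute _ _ (H₁.uniqueUpToIso H₂) h H⟩
  have key : ∀ τ : h ⟶ k, ((ρ_ (D.y A)).inv ▷ h ≫ (α_ (D.y A) (𝟙 _) h).hom) ≫
      D.y A ◁ ((λ_ h).hom ≫ τ) = D.y A ◁ τ := fun τ => by simp
  refine ⟨fun τ τ' e => ?_, fun σ => ?_⟩
  · rw [← cancel_epi (λ_ h).hom]
    refine (H₃ k (D.y A ◁ τ)).unique (key τ) ((key τ').trans e.symm)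
  · obtain ⟨τ, hτ, -⟩ := H₃ k σ
    refine ⟨(λ_ h).inv ≫ τ, ?_⟩
    refine (key ((λ_ h).inv ≫ τ)).symm.trans (Eq.trans ?_ hτ)
    exact congrArg (fun t => (((ρ_ (D.y A)).inv ▷ h ≫ (α_ (D.y A) (𝟙 _) h).hom) ≫ D.y A ◁ t))
      (Iso.hom_inv_id_assoc (λ_ h) τ)

namespace Kleisli

/-- Restriction of 1-cells along the unit. -/
@[reducible]
def restrictUnit (A B : Kleisli D) : (A ⟶ B) ⥤ (A.base ⟶ D.obj B.base) where
  obj h := D.y A.base ≫ h.hom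
  map s := D.y A.base ◁ s.hom
  map_id h := Bicategory.whiskerLeft_id _ h.hom
  map_comp s t := Bicategory.whiskerLeft_comp _ s.hom t.hom

theorem restrictUnit_map_whiskerRight {A B C : Kleisli D} {h k : A ⟶ B} (s : h ⟶ k)
    (l : B ⟶ C) : (restrictUnit A C).map (s ▷ l) =
      (α_ (D.y A.base) h.hom l.hom).inv ≫ (restrictUnit A B).map s ▷ l.hom ≫
        (α_ (D.y A.base) k.hom l.hom).hom :=
  whisker_assoc_symm (D.y A.base) s.hom l.hom

theorem comp_hom₂ {A B : Kleisli D} {h k l : A ⟶ B} (s : h ⟶ k) (t : k ⟶ l) :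
    (s ≫ t).hom = s.hom ≫ t.hom := rfl

theorem whiskerLeft_hom₂ {A B C : Kleisli D} (h : A ⟶ B) {k l : B ⟶ C} (s : k ⟶ l) :
    (h ◁ s).hom = h.hom ◁ s.hom := rfl

theorem whiskerRight_hom₂ {A B C : Kleisli D} {h k : A ⟶ B} (s : h ⟶ k) (l : B ⟶ C) :
    (s ▷ l).hom = s.hom ▷ l.hom := rfl

variable (D) in
/-- The extension of a 1-cell along the unit. -/
def extend {A B : K} (f : A ⟶ D.obj B) : (⟨A⟩ : Kleisli D) ⟶ ⟨B⟩ :=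
  ⟨(D.ext f).extension, fun _ g => D.ext_preserves f g⟩

variable (D) in
/-- The extension of a 1-cell along the unit restricts to the 1-cell. -/
noncomputable def extendIso {A B : K} (f : A ⟶ D.obj B) : D.y A ≫ (extend D f).hom ≅ f :=
  haveI := D.ext_isIso f
  (asIso (D.ext f).unit).symm

/-- Together with the next three instances: Kleisli 1-cells are the 1-cells of `K` into a free
algebra. Full faithfulness is the Kan property of pseudomorphisms, and essential surjectivity is the
invertibility of the unit of the chosen extension. -/
instance (A B : Kleisli D) : (restrictUnit A B).Faithful where
  map_injective {h _} _ _ e := hom₂_ext ((h.isPseudomorphism.bijective_whiskerLeft _).1 e)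

instance (A B : Kleisli D) : (restrictUnit A B).Full where
  map_surjective {h _} σ := by
    obtain ⟨τ, hτ⟩ := (h.isPseudomorphism.bijective_whiskerLeft _).2 σ
    exact ⟨⟨τ⟩, hτ⟩

instance (A B : Kleisli D) : (restrictUnit A B).EssSurj where
  mem_essImage f := ⟨extend D f, ⟨extendIso D f⟩⟩

instance (A B : Kleisli D) : (restrictUnit A B).IsEquivalence where

variable {J : Type u₂} [Bicategory.{w₂, v₂} J] {W : J ⥤ᵖ Cat.{v₃, u₃}}
  {F : StrictPseudofunctor J (Kleisli D)}

/-- The underlying isomorphism in `K` of an invertible 2-cell. -/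
@[reducible]
def homIso {A B : Kleisli D} {h k : A ⟶ B} (i : h ≅ k) : h.hom ≅ k.hom where
  hom := i.hom.hom
  inv := i.inv.hom
  hom_inv_id := congrArg Hom₂.hom i.hom_inv_id
  inv_hom_id := congrArg Hom₂.hom i.inv_hom_id

theorem homIso_eqToIso {A B : Kleisli D} {h k : A ⟶ B} (e : h = k) :
    homIso (eqToIso e) = eqToIso (congrArg Hom.hom e) := by
  subst e; rfl

/-- The underlying 2-functor to `K` of a 2-functor to the Kleisli 2-category. -/
@[reducible]
def underlying (F : StrictPseudofunctor J (Kleisli D)) : StrictPseudofunctor J K where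
  obj j := D.obj (F.obj j).base
  map f := (F.map f).hom
  map₂ η := (F.map₂ η).hom
  map₂_id f := congrArg Hom₂.hom (F.map₂_id f)
  map₂_comp η θ := congrArg Hom₂.hom (F.map₂_comp η θ)
  mapId j := homIso (F.mapId j)
  mapComp f g := homIso (F.mapComp f g)
  map₂_whisker_left f _ _ η := congrArg Hom₂.hom (F.map₂_whisker_left f η)
  map₂_whisker_right η f := congrArg Hom₂.hom (F.map₂_whisker_right η f)
  map₂_associator f g h := congrArg Hom₂.hom (F.map₂_associator f g h)
  map₂_left_unitor f := congrArg Hom₂.hom (F.map₂_left_unitor f)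
  map₂_right_unitor f := congrArg Hom₂.hom (F.map₂_right_unitor f)
  map_id j := congrArg Hom.hom (F.map_id j)
  map_comp f g := congrArg Hom.hom (F.map_comp f g)
  mapId_eq_eqToIso j :=
    (congrArg homIso (F.mapId_eq_eqToIso j)).trans (homIso_eqToIso _)
  mapComp_eq_eqToIso f g :=
    (congrArg homIso (F.mapComp_eq_eqToIso f g)).trans (homIso_eqToIso _)

/-- The underlying cone in `K` of a cone in the Kleisli 2-category. -/
@[reducible]
def forgetCone (W : J ⥤ᵖ Cat.{v₃, u₃}) (F : StrictPseudofunctor J (Kleisli D)) (A : Kleisli D) :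
    WCone W F.toPseudofunctor A ⥤ WCone W (underlying F).toPseudofunctor (D.obj A.base) where
  obj c :=
    { app := fun j =>
        { obj := fun x => ((c.app j).obj x).hom
          map := fun p => ((c.app j).map p).hom
          map_id := fun x => congrArg Hom₂.hom ((c.app j).map_id x)
          map_comp := fun p q => congrArg Hom₂.hom ((c.app j).map_comp p q) }
      nat := fun f x => homIso (c.nat f x)
      nat_naturality := fun f x y p => congrArg Hom₂.hom (c.nat_naturality f p)
      nat_map₂ := fun η x => congrArg Hom₂.hom (c.nat_map₂ η x)
      nat_id := fun j x => congrArg Hom₂.hom (c.nat_id j x)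
      nat_comp := fun f g x => congrArg Hom₂.hom (c.nat_comp f g x) }
  map s :=
    { app := fun j =>
        { app := fun x => ((s.app j).app x).hom
          naturality := fun x y p => congrArg Hom₂.hom ((s.app j).naturality p) }
      comm := fun f x => congrArg Hom₂.hom (s.comm f x) }

/-- Cones in the Kleisli 2-category restrict along the unit to cones in `K`. -/
@[reducible]
def restrictUnitCone (W : J ⥤ᵖ Cat.{v₃, u₃}) (F : StrictPseudofunctor J (Kleisli D))
    (A : Kleisli D) :
    WCone W F.toPseudofunctor A ⥤ WCone W (underlying F).toPseudofunctor A.base :=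
  forgetCone W F A ⋙ WCone.restrictFunctor (D.y A.base)

theorem restrictUnitCone_map_app {A : Kleisli D} {c d : WCone W F.toPseudofunctor A} (s : c ⟶ d)
    (j : J) (x : W.obj j) : (((restrictUnitCone W F A).map s).app j).app x =
      (restrictUnit A (F.obj j)).map ((s.app j).app x) := rfl

instance (A : Kleisli D) : (restrictUnitCone W F A).Faithful where
  map_injective {c d s t} e := by
    ext j x
    apply congrArg Hom₂.hom
    apply (restrictUnit A (F.obj j)).map_injective
    rw [← restrictUnitCone_map_app, e, restrictUnitCone_map_app]

/-- The components lift one at a time; naturality and the modification axiom may then be checked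
after the faithful restriction along the unit, where they hold for `s`. -/
instance (A : Kleisli D) : (restrictUnitCone W F A).Full where
  map_surjective {c d} s := by
    choose τ hτ using fun (j : J) (x : W.obj j) =>
      (restrictUnit A (F.obj j)).map_surjective (X := (c.app j).obj x) (Y := (d.app j).obj x)
        ((s.app j).app x)
    refine ⟨{ app := fun j => { app := τ j, naturality := fun x y p => ?_ }
              comm := fun {i j} f x => ?_ }, ?_⟩
    · apply (restrictUnit A (F.obj j)).map_injective
      rw [Functor.map_comp, Functor.map_comp, hτ, hτ]
      exact (s.app j).naturality p
    · have h : (restrictUnit A (F.obj j)).map (τ j ((W.map f).toFunctor.obj x)) ≫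
          (restrictUnit A (F.obj j)).map (d.nat f x).hom ≫
            (α_ (D.y A.base) ((d.app i).obj x).hom (F.map f).hom).inv =
          ((restrictUnit A (F.obj j)).map (c.nat f x).hom ≫
            (α_ (D.y A.base) ((c.app i).obj x).hom (F.map f).hom).inv) ≫
              (restrictUnit A (F.obj i)).map (τ i x) ▷ (F.map f).hom := by
        rw [hτ, hτ]
        exact s.comm f x
      apply (restrictUnit A (F.obj j)).map_injective
      rw [Functor.map_comp, Functor.map_comp, restrictUnit_map_whiskerRight]
      rw [← Category.assoc] at h
      refine ((Iso.comp_inv_eq _).1 h).trans ?_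
      simp only [Category.assoc]
    · ext j x
      exact hτ j x

/-- Restriction of 1-cells along the unit, as an equivalence. -/
noncomputable abbrev restrictUnitEquiv (A B : Kleisli D) : (A ⟶ B) ≌ (A.base ⟶ D.obj B.base) :=
  (restrictUnit A B).asEquivalence

/-- A 1-cell of `K` with codomain a free algebra is the restriction of its extension. -/
noncomputable abbrev restrictUnitIso (A B : Kleisli D) (q : A.base ⟶ D.obj B.base) :
    (restrictUnit A B).obj ((restrictUnitEquiv A B).inverse.obj q) ≅ q :=
  (restrictUnitEquiv A B).counitIso.app q

theorem restrictUnit_map_inverse_map {A B : Kleisli D} {q q' : A.base ⟶ D.obj B.base}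
    (p : q ⟶ q') : D.y A.base ◁ ((restrictUnitEquiv A B).inverse.map p).hom =
      (restrictUnitIso A B q).hom ≫ p ≫ (restrictUnitIso A B q').inv :=
  (restrictUnitEquiv A B).fun_inv_map _ _ p

/-- The naturality isomorphism of the extension of a cone. -/
noncomputable def extendConeNat {A : Kleisli D}
    (c : WCone W (underlying F).toPseudofunctor A.base) {i j : J} (f : i ⟶ j) (x : W.obj i) :
    (restrictUnitEquiv A (F.obj j)).inverse.obj ((c.app j).obj ((W.map f).toFunctor.obj x)) ≅
      (restrictUnitEquiv A (F.obj i)).inverse.obj ((c.app i).obj x) ≫ F.map f :=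
  (restrictUnit A (F.obj j)).preimageIso (restrictUnitIso A (F.obj j) _ ≪≫ c.nat f x ≪≫
    whiskerRightIso (restrictUnitIso A (F.obj i) ((c.app i).obj x)).symm (F.map f).hom ≪≫
      α_ (D.y A.base) ((restrictUnitEquiv A (F.obj i)).inverse.obj ((c.app i).obj x)).hom
        (F.map f).hom)

theorem restrictUnit_map_extendConeNat {A : Kleisli D}
    (c : WCone W (underlying F).toPseudofunctor A.base) {i j : J} (f : i ⟶ j) (x : W.obj i) :
    D.y A.base ◁ (extendConeNat c f x).hom.hom =
      (restrictUnitIso A (F.obj j) _).hom ≫ (c.nat f x).hom ≫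
        (restrictUnitIso A (F.obj i) ((c.app i).obj x)).inv ▷ (F.map f).hom ≫
          (α_ (D.y A.base) ((restrictUnitEquiv A (F.obj i)).inverse.obj ((c.app i).obj x)).hom
            (F.map f).hom).hom :=
  (restrictUnit A (F.obj j)).map_preimage _

/-- The extension of a cone along the unit. -/
noncomputable def extendCone {A : Kleisli D}
    (c : WCone W (underlying F).toPseudofunctor A.base) : WCone W F.toPseudofunctor A where
  app j := c.app j ⋙ (restrictUnitEquiv A (F.obj j)).inverse
  nat f x := extendConeNat c f x
  nat_naturality {i j} f x y p := by
    -- As restriction is faithful, each axiom may be checked after whiskering with the unit, where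
    -- it is a conjugate of the axiom for `c`.
    apply (restrictUnit A (F.obj j)).map_injective
    have h := c.nat_naturality f p
    dsimp only [Functor.comp_map]
    simp only [comp_hom₂, Bicategory.whiskerLeft_comp, restrictUnit_map_extendConeNat,
      restrictUnit_map_inverse_map, whiskerRight_hom₂, whisker_assoc_symm]
    exact conj_nat_naturality _ _ _ _ _ _ _ _ h
  nat_map₂ {i j f g} η x := by
    apply (restrictUnit A (F.obj j)).map_injective
    have h := c.nat_map₂ η x
    dsimp only [Functor.comp_map]
    simp only [comp_hom₂, Bicategory.whiskerLeft_comp, restrictUnit_map_extendConeNat,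
      restrictUnit_map_inverse_map, whiskerLeft_hom₂, comp_whiskerLeft_symm]
    exact conj_nat_map₂ _ _ _ _ _ _ _ h
  nat_id j x := by
    apply (restrictUnit A (F.obj j)).map_injective
    have h := c.nat_id j x
    dsimp only [Functor.comp_map]
    simp only [comp_hom₂, Bicategory.whiskerLeft_comp, restrictUnit_map_extendConeNat,
      restrictUnit_map_inverse_map, whiskerLeft_hom₂, comp_whiskerLeft_symm]
    exact conj_nat_id _ _ _ _ _ h
  nat_comp {i j k} f g x := by
    apply (restrictUnit A (F.obj k)).map_injective
    have h := c.nat_comp f g x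
    dsimp only [Functor.comp_map]
    simp only [comp_hom₂, Bicategory.whiskerLeft_comp, restrictUnit_map_extendConeNat,
      restrictUnit_map_inverse_map, whiskerLeft_hom₂,
      whiskerRight_hom₂, comp_whiskerLeft_symm, whisker_assoc_symm]
    exact conj_nat_comp _ _ _ _ _ _ _ _ _ h

/-- The extension of a cone restricts to the cone. -/
noncomputable def restrictUnitConeExtendConeIso {A : Kleisli D}
    (c : WCone W (underlying F).toPseudofunctor A.base) :
    (restrictUnitCone W F A).obj (extendCone c) ≅ c :=
  WCone.isoMk
    (fun j => NatIso.ofComponents (fun x => restrictUnitIso A (F.obj j) ((c.app j).obj x))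
      (fun p => (restrictUnitEquiv A (F.obj j)).counitIso.hom.naturality _))
    (fun {i j} f x => by
      change _ = (D.y A.base ◁ (extendConeNat c f x).hom.hom ≫ (α_ (D.y A.base) _ _).inv) ≫ _
      rw [restrictUnit_map_extendConeNat]
      exact conj_nat_isoMk _ _ _)

end Kleisli

end Kleisli

end ReflLimit

namespace ReflLimit

/-! ### Reflector-limits in the Kleisli 2-category -/

namespace Kleisli

variable {K : Type u₁} [Bicategory.{w₁, v₁} K] {D : LeftKanPseudomonad K}
  {J : Type u₂} [Bicategory.{w₂, v₂} J] {W : J ⥤ᵖ Cat.{v₃, u₃}}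
  {F : StrictPseudofunctor J (Kleisli D)}

/-- An isomorphism `y ≫ r ≅ 𝟙` is the counit of an adjunction `r ⊣ y`, provided that restriction
along the unit is faithful on 2-cells out of `r`. -/
theorem exists_adjunction {L : K} (r : D.obj L ⟶ L) (e : D.y L ≫ r ≅ 𝟙 L)
    (hr : ∀ k, Function.Injective (fun τ : r ⟶ k => D.y L ◁ τ)) :
    ∃ adj : Bicategory.Adjunction r (D.y L), IsIso adj.counit := by
  -- The identity is a pseudomorphism, so a unit `𝟙 ⟶ r ≫ y` may be prescribed by its restriction
  -- along `y`, here `e.inv` whiskered with `y`. The right triangle identity then follows by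
  -- substitution.
  obtain ⟨η, hη⟩ :=
    ((LeftKanPseudomonad.IsPseudomorphism.id D L).bijective_whiskerLeft (r ≫ D.y L)).2
      ((ρ_ (D.y L)).hom ≫ (λ_ (D.y L)).inv ≫ e.inv ▷ D.y L ≫ (α_ _ _ _).hom)
  dsimp only at hη
  have left : leftZigzag η e.hom = (λ_ r).hom ≫ (ρ_ r).inv := by
    -- The source is turned from `𝟙 ≫ r` into `r`, so that `hr` applies.
    rw [← cancel_epi (λ_ r).inv]
    apply hr
    have h₁ : D.y L ◁ ((λ_ r).inv ≫ (η ▷ r ⊗≫ r ◁ e.hom)) =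
        𝟙 _ ⊗≫ (D.y L ◁ η) ▷ r ⊗≫ (D.y L ≫ r) ◁ e.hom ⊗≫ 𝟙 _ := by bicategory
    -- By interchange, the two whiskerings of `e` with its own source agree after composing with
    -- `e`, which is invertible. This brings `e.hom` next to the `e.inv` contained in the unit.
    have h₂ : (D.y L ≫ r) ◁ e.hom =
        e.hom ▷ (D.y L ≫ r) ≫ (λ_ _).hom ≫ (ρ_ _).inv := by
      have h := whisker_exchange e.hom e.hom
      rw [← cancel_mono (e.hom ▷ 𝟙 L), h]
      simp
    refine h₁.trans ?_
    rw [hη, h₂]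
    calc
      _ = 𝟙 _ ⊗≫ (e.inv ≫ e.hom) ▷ (D.y L ≫ r) ⊗≫ 𝟙 _ := by bicategory
      _ = _ := by rw [e.inv_hom_id]; bicategory
  have right : rightZigzag η e.hom = (ρ_ (D.y L)).hom ≫ (λ_ (D.y L)).inv := by
    dsimp only [rightZigzag]
    rw [hη]
    calc
      _ = 𝟙 _ ⊗≫ (e.inv ≫ e.hom) ▷ D.y L ⊗≫ 𝟙 _ := by bicategory
      _ = _ := by rw [e.inv_hom_id]; bicategory
  exact ⟨⟨η, e.hom, left, right⟩, inferInstanceAs (IsIso e.hom)⟩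

/-- Restriction along the unit is faithful on 2-cells that are jointly detected by
pseudomorphisms. -/
theorem whiskerRight_eq_of_unit {A B L : K} {r k : D.obj A ⟶ L} (q : L ⟶ D.obj B)
    {h : D.obj A ⟶ D.obj B} (hh : D.IsPseudomorphism h) (w : r ≫ q ≅ h) {τ τ' : r ⟶ k}
    (e : D.y A ◁ τ = D.y A ◁ τ') : τ ▷ q = τ' ▷ q := by
  rw [← cancel_epi w.inv]
  apply (hh.bijective_whiskerLeft _).1
  simp only [Bicategory.whiskerLeft_comp, whisker_assoc_symm, e]

/-- The comparison functor of a cone in the Kleisli 2-category, after restriction along the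
unit. -/
def comparisonRestrictUnit {A L : Kleisli D} (c : WCone W F.toPseudofunctor L) :
    c.comparison A ⋙ restrictUnitCone W F A ≅
      restrictUnit A L ⋙ ((forgetCone W F L).obj c).comparison A.base :=
  NatIso.ofComponents
    (fun θ => (((forgetCone W F L).obj c).restrictComp (D.y A.base) θ.hom).symm)
    (fun {θ θ'} τ => by
      ext j x
      exact (associator_inv_naturality_middle (D.y A.base) τ.hom ((c.app j).obj x).hom :))

/-- The bilimit of the underlying diagram is a reflective retract `r ⊣ y` of `DL`. The right adjoint
of the comparison at `A` classifies the restricted cone by some `t : A ⟶ L` and extends `t ≫ y` to a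
Kleisli 1-cell `g`. -/
theorem isReflectorLimit_of_isBilimit {L : Kleisli D} (μ : WCone W F.toPseudofunctor L)
    {c : WCone W (underlying F).toPseudofunctor L.base}
    (i : ((forgetCone W F L).obj μ).restrict (D.y L.base) ≅ c) (hc : c.IsBilimit) :
    μ.IsReflectorLimit := by
  let ν := (forgetCone W F L).obj μ
  have hD := hc (D.obj L.base)
  have hL := hc L.base
  let r : D.obj L.base ⟶ L.base := (c.comparison (D.obj L.base)).objPreimage ν
  let ir : c.restrict r ≅ ν := (c.comparison (D.obj L.base)).objObjPreimageIso ν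
  let e : D.y L.base ≫ r ≅ 𝟙 L.base := (c.comparison L.base).preimageIso
    (c.restrictComp (D.y L.base) r ≪≫ (WCone.restrictFunctor (D.y L.base)).mapIso ir ≪≫ i ≪≫
      c.restrictId.symm)
  -- Two 2-cells out of `r` agree if they agree after whiskering with every leg of `c`, and `ir`
  -- makes each composite of `r` with a leg isomorphic to a pseudomorphism.
  obtain ⟨adj, _⟩ := exists_adjunction r e fun k τ τ' h => by
    apply (c.comparison (D.obj L.base)).map_injective
    ext j x
    exact whiskerRight_eq_of_unit ((c.app j).obj x) ((μ.app j).obj x).isPseudomorphism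
      ⟨(ir.hom.app j).app x, (ir.inv.app j).app x,
        congrArg (fun s => (WCone.Hom.app s j).app x) ir.hom_inv_id,
        congrArg (fun s => (WCone.Hom.app s j).app x) ir.inv_hom_id⟩ h
  refine fun A => isReflector_of_bijectiveInto _ fun d => ?_
  have hA := hc A.base
  let S := restrictUnitCone W F A
  let t : A.base ⟶ L.base := (c.comparison A.base).objPreimage (S.obj d)
  let it : c.restrict t ≅ S.obj d := (c.comparison A.base).objObjPreimageIso (S.obj d)
  let g : A ⟶ L := (restrictUnit A L).objPreimage (t ≫ D.y L.base)
  let ig : D.y A.base ≫ g.hom ≅ t ≫ D.y L.base :=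
    (restrictUnit A L).objObjPreimageIso (t ≫ D.y L.base)
  refine ⟨g, ⟨S.preimageIso ?_⟩, ?_⟩
  -- Restricted along the unit, `μ` at `g` becomes `ν` at `t ≫ y`, that is, `c` at `t`, which is the
  -- restriction of `d`. The restriction functor is fully faithful, so this isomorphism lifts.
  · exact (ν.restrictComp (D.y A.base) g.hom).symm ≪≫ (ν.comparison A.base).mapIso ig ≪≫
      ν.restrictComp t (D.y L.base) ≪≫ (WCone.restrictFunctor t).mapIso i ≪≫ it
  · refine BijectiveInto.of_comp (G := S) ?_
    refine BijectiveInto.of_natIso (comparisonRestrictUnit μ).symm ?_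
    refine BijectiveInto.comp ?_
    -- The cone `ν` is `c` restricted along `r`, so its comparison is postcomposition with `r`
    -- followed by the equivalence given by `c`.
    refine BijectiveInto.of_natIso
      (WCone.comparisonRestrict c r A.base ≪≫ WCone.comparisonIso ir A.base) ?_
    refine BijectiveInto.comp_right ?_
    exact (bijectiveInto_postcomp adj t).of_iso ig.symm

theorem hasWeightedReflectorLimits (K : Type u₁) [Bicategory.{w₁, v₁} K]
    (J : Type u₂) [Bicategory.{w₂, v₂} J] (D : LeftKanPseudomonad K)
    (H : HasWeightedBilimits.{w₁, v₁, u₁, w₂, v₂, u₂, v₃, u₃} J K) :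
    HasWeightedReflectorLimits.{w₁, v₁, u₁, w₂, v₂, u₂, v₃, u₃} J (Kleisli D) := by
  intro F W
  obtain ⟨L, c, hc⟩ := H (underlying F) W
  exact ⟨⟨L⟩, extendCone (A := ⟨L⟩) c,
    isReflectorLimit_of_isBilimit _ (restrictUnitConeExtendConeIso (A := ⟨L⟩) c) hc⟩

end Kleisli

end ReflLimit

namespace ReflLimit

open Opposite Limits

/-! ### Reflector-limits of small profunctors -/

/-- There is only a small set of transformations out of a small presheaf. -/
theorem IsSmallPresheaf.small_hom {B : Type (u + 1)} [Category.{u} B] (P Q : Bᵒᵖ ⥤ Type u)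
    [IsSmallPresheaf P] : Small.{u} (P ⟶ Q) := by
  obtain ⟨I, _, X, e, -, gen, -⟩ := IsSmallPresheaf.exists_gen P
  -- By naturality a transformation is determined by its values on the small family of generating
  -- elements.
  refine small_of_injective (β := ∀ i : I, Q.obj (op (X.obj i))) (f := fun s i => s.app _ (e i))
    fun s t h => ?_
  ext b p
  obtain ⟨i, φ, rfl⟩ := gen b.unop p
  refine (NatTrans.naturality_apply s φ.op (e i)).trans ?_
  exact (congrArg (Q.map φ.op) (congrFun h i)).trans (NatTrans.naturality_apply t φ.op (e i)).symm

/-! ### Transformations out of a composite profunctor, one element at a time. -/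

namespace SmallProfunctor

section

variable {A B C : Type (u + 1)} [Category.{u} A] [Category.{u} B] [Category.{u} C]

theorem isIso_of_bijective {H G : SmallProfunctor A B} (s : H ⟶ G)
    (hs : ∀ a b, Function.Bijective (fun h : (H.prof.obj a).obj b => Hom.ap s h)) : IsIso s := by
  have h₁ : ∀ a, IsIso (s.hom.app a) := fun a => by
    have h₂ : ∀ b, IsIso ((s.hom.app a).app b) := fun b => (isIso_iff_bijective _).2 (hs a b)
    exact NatIso.isIso_of_isIso_app _
  have h₃ : IsIso s.hom := NatIso.isIso_of_isIso_app _
  exact ⟨⟨⟨inv s.hom⟩, Hom.ext (IsIso.hom_inv_id s.hom), Hom.ext (IsIso.inv_hom_id s.hom)⟩⟩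

/-- An isomorphism of small profunctors from a natural isomorphism. -/
@[simps]
def isoOfNatIso {H G : SmallProfunctor A B} (i : H.prof ≅ G.prof) : H ≅ G where
  hom := ⟨i.hom⟩
  inv := ⟨i.inv⟩
  hom_inv_id := Hom.ext i.hom_inv_id
  inv_hom_id := Hom.ext i.inv_hom_id

/-- Restriction of small profunctors along a functor. -/
@[simps]
def pre {A' : Type (u + 1)} [Category.{u} A'] (t : A' ⥤ A) :
    SmallProfunctor A B ⥤ SmallProfunctor A' B where
  obj H := ⟨t ⋙ H.prof, fun a => H.small (t.obj a)⟩
  map s := ⟨Functor.whiskerLeft t s.hom⟩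

theorem whiskerRight_app {H K : SmallProfunctor A B} (σ : H ⟶ K) (G : SmallProfunctor B C)
    (a : A) : (whiskerRight σ G).hom.app a = Tens.map (σ.hom.app a) (𝟙 G.prof) :=
  Tens.hom_ext fun _ b p x =>
    (ap_whiskerRight σ G b p x).trans (Tens.map_mk (σ.hom.app a) (𝟙 G.prof) b p x).symm

/-- The presheaf map determined by an element of the first factor and a transformation out of a
composite. -/
noncomputable def sect {H : SmallProfunctor A B} {G : SmallProfunctor B C} {K : SmallProfunctor A C}
    (σ : H.comp G ⟶ K) {a : A} {b : B} (h : (H.prof.obj a).obj (op b)) :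
    G.prof.obj b ⟶ K.prof.obj a where
  app _ := ↾(fun x => Hom.ap σ (pair b h x))
  naturality c c' f := by
    ext x
    change Hom.ap σ (pair b h ((G.prof.obj b).map f x)) =
      (K.prof.obj a).map f (Hom.ap σ (pair b h x))
    rw [← ap_map, map_pair]

/-- Fixing the element `h` turns reassociation and whiskering into functoriality of the coend with
`M`. This removes associators from the modification axiom in `comm_iff`. -/
theorem ap_assocInv_whiskerRight {D : Type (u + 1)} [Category.{u} D] {H : SmallProfunctor A B}
    {G : SmallProfunctor B C} {K : SmallProfunctor A C} (σ : H.comp G ⟶ K)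
    (M : SmallProfunctor C D) {a : A} {b : B} (h : (H.prof.obj a).obj (op b)) {d : Dᵒᵖ}
    (w : ((G.comp M).prof.obj b).obj d) :
    Hom.ap (whiskerRight σ M) (Hom.ap (assocInv H G M) (pair b h w)) =
      (Tens.map (sect σ h) (𝟙 M.prof)).app d w := by
  induction w using pair_ind with | w c x m
  rw [ap_assocInv, ap_whiskerRight]
  exact (Tens.map_mk (sect σ h) (𝟙 M.prof) c x m).symm

end

end SmallProfunctor

/-! ### Cones with vertex the terminal category, and the universal cone. -/

namespace Prof

open SmallProfunctor

/-- The terminal category. -/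
structure Point : Type (u + 1)

instance : Category.{u} Point.{u} where
  Hom _ _ := PUnit.{u + 1}
  id _ := ⟨⟩
  comp _ _ := ⟨⟩

/-- The terminal category as an object of the bicategory of small profunctors. -/
abbrev point : Prof.{u} := ⟨Cat.of Point.{u}⟩

/-- The object of the terminal category. -/
abbrev pt : Point.{u} := ⟨⟩

theorem point_map {B : Type (u + 1)} [Category.{u} B] (H : SmallProfunctor Point.{u} B)
    (f : pt.{u} ⟶ pt) : H.prof.map f = 𝟙 (H.prof.obj pt) :=
  H.prof.map_id pt

/-- Transformations of profunctors out of the terminal category are maps of presheaves. -/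
@[simps]
def pointHom {B : Type (u + 1)} [Category.{u} B] {H G : SmallProfunctor Point.{u} B}
    (t : H.prof.obj pt ⟶ G.prof.obj pt) : H ⟶ G :=
  Hom.mk { app := fun _ => t
           naturality := fun x y f => by
             change H.prof.map (X := pt) (Y := pt) f ≫ t = t ≫ G.prof.map (X := pt) (Y := pt) f
             rw [point_map, point_map, Category.id_comp, Category.comp_id] }

theorem pointHom_ext {B : Type (u + 1)} [Category.{u} B] {H G : SmallProfunctor Point.{u} B}
    {s t : H ⟶ G} (h : s.hom.app pt = t.hom.app pt) : s = t := by
  apply Hom.ext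
  ext x : 2
  exact h

theorem small_hom_point {B : Type (u + 1)} [Category.{u} B] (H G : SmallProfunctor Point.{u} B) :
    Small.{u} (H ⟶ G) :=
  haveI := IsSmallPresheaf.small_hom (H.prof.obj pt) (G.prof.obj pt)
  small_of_injective (f := fun s : H ⟶ G => s.hom.app pt) fun _ _ h => pointHom_ext h

variable {J : Type u} [Bicategory.{u, u} J] {F : J ⥤ᵖ Prof.{u}} {W : J ⥤ᵖ Cat.{u, u}}

/-- A morphism of cones is a family of presheaf maps indexed by the small data `J` and `W`, and each
such map ranges over a small set. This makes the category of cones an admissible vertex. -/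
instance (c d : WCone W F point) : Small.{u} (c ⟶ d) := by
  have : ∀ (j : J) (x : W.obj j), Small.{u} ((c.app j).obj x ⟶ (d.app j).obj x) := fun j x =>
    small_hom_point ((c.app j).obj x) ((d.app j).obj x)
  refine small_of_injective (β := ∀ (j : J) (x : W.obj j), (c.app j).obj x ⟶ (d.app j).obj x)
    (f := fun s j x => (s.app j).app x) fun s t h => ?_
  ext j x
  exact congrFun (congrFun h j) x

instance : LocallySmall.{u} (WCone W F point) where

/-- The restriction of a cone to a functor. -/
noncomputable def preCone {A A' : Prof.{u}} (t : A'.cat ⥤ A.cat) (c : WCone W F A) :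
    WCone W F A' where
  app j := c.app j ⋙ pre t
  -- Restriction along a functor commutes definitionally with composing a profunctor on the other
  -- side, so no coherence cells appear.
  nat f x := (pre t).mapIso (c.nat f x)
  nat_naturality f _ _ p := congrArg (pre t).map (c.nat_naturality f p)
  nat_map₂ η x := congrArg (pre t).map (c.nat_map₂ η x)
  nat_id j x := congrArg (pre t).map (c.nat_id j x)
  nat_comp f g x := congrArg (pre t).map (c.nat_comp f g x)

/-- The action of a morphism on the values of a cone. -/
noncomputable def evHom {A : Prof.{u}} (c : WCone W F A) {a a' : A.cat} (φ : a ⟶ a') (j : J)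
    (x : W.obj j) :
    (pre ((Functor.const Point).obj a)).obj
      ((c.app j).obj x : SmallProfunctor A.cat (F.obj j).cat) ⟶
      (pre ((Functor.const Point).obj a')).obj ((c.app j).obj x) :=
  pointHom (((c.app j).obj x).prof.map φ)

/-- The cones with vertex the terminal category obtained from a cone by evaluation. -/
noncomputable def evCone {A : Prof.{u}} (c : WCone W F A) : A.cat ⥤ WCone W F point where
  obj a := preCone ((Functor.const Point).obj a) c
  map {a a'} φ :=
    { app := fun j =>
        { app := fun x => evHom c φ j x
          naturality := fun x y p => pointHom_ext (((c.app j).map p).hom.naturality φ).symm }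
      comm := fun {i j} f x => pointHom_ext (by
        refine ((c.nat f x).hom.hom.naturality φ).trans ?_
        exact congrArg (fun t => (c.nat f x).hom.hom.app a ≫ t)
          (whiskerRight_app (evHom c φ i x) (F.map f) pt).symm) }
  map_id a := by
    ext j x
    exact pointHom_ext (((c.app j).obj x).prof.map_id a)
  map_comp φ ψ := by
    ext j x
    exact pointHom_ext (((c.app j).obj x).prof.map_comp φ ψ)

variable (F W) in
/-- The vertex of the reflector-limit: the category of cones with vertex the terminal category. -/
noncomputable abbrev limitVertex : Prof.{u} := ⟨Cat.of (ShrinkHoms (WCone W F point))⟩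

variable (F W) in
/-- The cone with vertex the terminal category given by an object of the reflector-limit. -/
noncomputable abbrev toCone : (limitVertex F W).cat ⥤ WCone W F point :=
  ShrinkHoms.inverse (WCone W F point)

variable (F) in
/-- The presheaf at `x` of a cone with vertex the terminal category. -/
def presheafAt (j : J) (x : W.obj j) : WCone W F point ⥤ (F.obj j).catᵒᵖ ⥤ Type u where
  obj c := ((c.app j).obj x).prof.obj pt
  map s := ((s.app j).app x).hom.app pt

/-- The naturality isomorphism of the universal cone. -/
noncomputable def limitConeNat {i j : J} (f : i ⟶ j) (x : W.obj i) :
    (⟨toCone F W ⋙ presheafAt F j ((W.map f).toFunctor.obj x), fun l =>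
        ((((toCone F W).obj l).app j).obj ((W.map f).toFunctor.obj x)).small pt⟩ :
        SmallProfunctor (limitVertex F W).cat (F.obj j).cat) ≅
      (⟨toCone F W ⋙ presheafAt F i x, fun l => ((((toCone F W).obj l).app i).obj x).small pt⟩ :
        SmallProfunctor (limitVertex F W).cat (F.obj i).cat).comp (F.map f) :=
  isoOfNatIso (NatIso.ofComponents
    (fun l => ⟨(((toCone F W).obj l).nat f x).hom.hom.app pt,
      (((toCone F W).obj l).nat f x).inv.hom.app pt,
      congrArg (fun s => (Hom.hom s).app pt) (((toCone F W).obj l).nat f x).hom_inv_id,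
      congrArg (fun s => (Hom.hom s).app pt) (((toCone F W).obj l).nat f x).inv_hom_id⟩)
    (fun {l l'} m => by
      -- Naturality in the object of the vertex is the modification axiom of the morphism of cones
      -- `m`.
      refine (congrArg (fun s => (Hom.hom s).app pt) (((toCone F W).map m).comm f x)).trans ?_
      exact congrArg (fun t => (((toCone F W).obj l).nat f x).hom.hom.app pt ≫ t)
        (whiskerRight_app ((((toCone F W).map m).app i).app x) (F.map f) pt)))

variable (F W) in
/-- The universal cone. -/
noncomputable def limitCone : WCone W F (limitVertex F W) where
  app j :=
    { obj := fun x =>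
        (⟨toCone F W ⋙ presheafAt F j x,
          fun l => ((((toCone F W).obj l).app j).obj x).small pt⟩ :
          SmallProfunctor (limitVertex F W).cat (F.obj j).cat)
      map := fun p =>
        ⟨{ app := fun l => ((((toCone F W).obj l).app j).map p).hom.app pt
           naturality := fun l l' m => congrArg (fun s => (Hom.hom s).app pt)
              ((((toCone F W).map m).app j).naturality p).symm }⟩
      map_id := fun x => by
        apply Hom.ext
        ext l : 2
        exact congrArg (fun s => (Hom.hom s).app pt) ((((toCone F W).obj l).app j).map_id x)
      map_comp := fun p q => by
        apply Hom.ext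
        ext l : 2
        exact congrArg (fun s => (Hom.hom s).app pt) ((((toCone F W).obj l).app j).map_comp p q) }
  nat f x := limitConeNat f x
  nat_naturality f x y p := by
    -- This axiom and the following ones hold at each object `l` of the vertex, because `l` is
    -- itself a cone.
    apply Hom.ext
    ext l : 2
    refine (congrArg (fun s => (Hom.hom s).app pt) (((toCone F W).obj l).nat_naturality f p)).trans ?_
    rfl
  nat_map₂ η x := by
    apply Hom.ext
    ext l : 2
    exact congrArg (fun s => (Hom.hom s).app pt) (((toCone F W).obj l).nat_map₂ η x)
  nat_id j x := by
    apply Hom.ext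
    ext l : 2
    refine (congrArg (fun s => (Hom.hom s).app pt) (((toCone F W).obj l).nat_id j x)).trans ?_
    rfl
  nat_comp f g x := by
    apply Hom.ext
    ext l : 2
    refine (congrArg (fun s => (Hom.hom s).app pt) (((toCone F W).obj l).nat_comp f g x)).trans ?_
    rfl

end Prof

end ReflLimit

/-! ### The classifying profunctor of a cone and its universal property. -/

namespace ReflLimit

open Opposite Limits

namespace Prof

open SmallProfunctor

variable {J : Type u} [Bicategory.{u, u} J] {F : J ⥤ᵖ Prof.{u}} {W : J ⥤ᵖ Cat.{u, u}}
  {A : Prof.{u}}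

instance {B : Prof.{u}} (P : point ⟶ B) :
    IsSmallPresheaf ((SmallProfunctor.prof P).obj pt) :=
  SmallProfunctor.small P pt

/-- The representable profunctor of the functor given by the values of a cone. -/
noncomputable def classifier (c : WCone W F A) : A ⟶ limitVertex F W :=
  (⟨(evCone c ⋙ ShrinkHoms.functor (WCone W F point)) ⋙ yoneda,
    fun _ => isSmallPresheaf_yoneda _⟩ : SmallProfunctor A.cat (limitVertex F W).cat)

/-- The morphism of cones given by an element of the representable profunctor. -/
noncomputable def classifierHom (c : WCone W F A) {a : A.cat} {l : (limitVertex F W).cat}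
    (m : ((SmallProfunctor.prof (classifier c)).obj a).obj (op l)) :
    (toCone F W).obj l ⟶ (evCone c).obj a :=
  (equivShrink _).symm m

theorem classifierHom_bijective (c : WCone W F A) {a : A.cat} {l : (limitVertex F W).cat} :
    Function.Bijective
      (classifierHom c : ((SmallProfunctor.prof (classifier c)).obj a).obj (op l) → _) :=
  (equivShrink _).symm.bijective

theorem classifierHom_map (c : WCone W F A) {a : A.cat} {l l' : (limitVertex F W).cat}
    (f : l' ⟶ l) (m : ((SmallProfunctor.prof (classifier c)).obj a).obj (op l)) :
    classifierHom c (((SmallProfunctor.prof (classifier c)).obj a).map f.op m) =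
      (toCone F W).map f ≫ classifierHom c m :=
  (equivShrink _).symm_apply_apply _

theorem classifierHom_app (c : WCone W F A) {a a' : A.cat} {l : (limitVertex F W).cat}
    (φ : a ⟶ a') (m : ((SmallProfunctor.prof (classifier c)).obj a).obj (op l)) :
    classifierHom c (((SmallProfunctor.prof (classifier c)).map φ).app (op l) m) =
      classifierHom c m ≫ (evCone c).map φ := by
  refine ((equivShrink _).symm_apply_apply _).trans ?_
  exact congrArg (fun t => classifierHom c m ≫ t) ((equivShrink _).symm_apply_apply _)

/-- The component of the counit. -/
noncomputable def counitHom (c : WCone W F A) (j : J) (x : W.obj j) :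
    (classifier c ≫ ((limitCone F W).app j).obj x : A ⟶ F.obj j) ⟶ (c.app j).obj x :=
  homMk (H := classifier c) (G := ((limitCone F W).app j).obj x) (K := (c.app j).obj x)
    (fun {a b} l m z => (((classifierHom c m).app j).app x).hom.app pt |>.app b z)
    (fun {a b} l l' g m z => by
      rw [classifierHom_map]
      rfl)
    (fun {a b b'} f l m z =>
      NatTrans.naturality_apply ((((classifierHom c m).app j).app x).hom.app pt) f z)
    (fun {a a' b} φ l m z => by
      rw [classifierHom_app]
      rfl)

theorem ap_counitHom (c : WCone W F A) {j : J} {x : W.obj j} {a : A.cat} {b : (F.obj j).catᵒᵖ}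
    (l : (limitVertex F W).cat) (m : ((SmallProfunctor.prof (classifier c)).obj a).obj (op l))
    (z : ((SmallProfunctor.prof (((limitCone F W).app j).obj x)).obj l).obj b) :
    Hom.ap (counitHom c j x) (pair l m z) =
      ((((classifierHom c m).app j).app x).hom.app pt).app b z :=
  ap_homMk _ _ _ _ _ _ _

/-- A transformation out of a coend is tested on pairs `(h, z)`. With `h` fixed, the modification
axiom becomes the axiom for a morphism of cones from `l` to the evaluation of `c` at `a`. It is used
in one direction for the counit and in the other for `sectHom`. -/
theorem comm_iff {H : A ⟶ limitVertex F W} (c : WCone W F A) {i j : J} (f : i ⟶ j)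
    (x : W.obj i) (s : H ≫ ((limitCone F W).app i).obj x ⟶ (c.app i).obj x)
    (s' : H ≫ ((limitCone F W).app j).obj ((W.map f).toFunctor.obj x) ⟶
      (c.app j).obj ((W.map f).toFunctor.obj x)) :
    s' ≫ (c.nat f x).hom = (((limitCone F W).restrict H).nat f x).hom ≫ s ▷ F.map f ↔
      ∀ (a : A.cat) (l : (limitVertex F W).cat) (h : ((SmallProfunctor.prof H).obj a).obj (op l)),
        sect s' h ≫ (c.nat f x).hom.hom.app a =
          (((toCone F W).obj l).nat f x).hom.hom.app pt ≫
            Tens.map (sect s h) (𝟙 (SmallProfunctor.prof (F.map f))) := by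
  have key : ∀ (a : A.cat) (b : (F.obj j).catᵒᵖ) (l : (limitVertex F W).cat)
      (h : ((SmallProfunctor.prof H).obj a).obj (op l))
      (z : ((SmallProfunctor.prof
        (((limitCone F W).app j).obj ((W.map f).toFunctor.obj x))).obj l).obj b),
      Hom.ap ((((limitCone F W).restrict H).nat f x).hom ≫ s ▷ F.map f) (pair l h z) =
        (Tens.map (sect s h) (𝟙 (SmallProfunctor.prof (F.map f)))).app b
          (((((toCone F W).obj l).nat f x).hom.hom.app pt).app b z) := fun a b l h z => by
    refine Eq.trans ?_ (ap_assocInv_whiskerRight s (F.map f) h _)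
    refine congrArg (fun t => Hom.ap (SmallProfunctor.whiskerRight s (F.map f))
      (Hom.ap (assocInv H _ (F.map f)) t)) ?_
    exact ap_whiskerLeft H (limitConeNat f x).hom l h z
  constructor
  · intro e a l h
    ext b z
    refine Eq.trans ?_ (key a b l h z)
    exact congrArg (fun t => Hom.ap t (pair l h z)) e
  · intro e
    refine hom_ext_pair fun {a b} l h z => ?_
    refine Eq.trans ?_ (key a b l h z).symm
    exact ConcreteCategory.congr_hom (NatTrans.congr_app (e a l h) b) z

theorem sect_counitHom (c : WCone W F A) (j : J) (x : W.obj j) {a : A.cat}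
    {l : (limitVertex F W).cat} (m : ((SmallProfunctor.prof (classifier c)).obj a).obj (op l)) :
    sect (counitHom c j x) m = (((classifierHom c m).app j).app x).hom.app pt := by
  ext b z
  exact ap_counitHom c l m z

theorem hom_comm_app {c d : WCone W F point} (s : c ⟶ d) {i j : J} (f : i ⟶ j) (x : W.obj i) :
    ((s.app j).app ((W.map f).toFunctor.obj x)).hom.app pt ≫ (d.nat f x).hom.hom.app pt =
      (c.nat f x).hom.hom.app pt ≫
        Tens.map (((s.app i).app x).hom.app pt) (𝟙 (SmallProfunctor.prof (F.map f))) := by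
  refine (congrArg (fun s => (Hom.hom s).app pt) (s.comm f x)).trans ?_
  exact congrArg (fun t => (c.nat f x).hom.hom.app pt ≫ t)
    (whiskerRight_app ((s.app i).app x) (F.map f) pt)

/-- The generic element of the representable profunctor. -/
noncomputable def classifierId (c : WCone W F A) (a : A.cat) :
    ((SmallProfunctor.prof (classifier c)).obj a).obj
      (op (ShrinkHoms.toShrinkHoms ((evCone c).obj a) : (limitVertex F W).cat)) :=
  𝟙 (ShrinkHoms.toShrinkHoms ((evCone c).obj a) : ShrinkHoms (WCone W F point))

/-- The co-Yoneda reduction: since `m` is the generic element acted on by `m`, the coend relation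
moves `m` over to `z`. -/
theorem pair_classifierId (c : WCone W F A) (j : J) (x : W.obj j) {a : A.cat}
    {b : (F.obj j).catᵒᵖ} (l : (limitVertex F W).cat)
    (m : ((SmallProfunctor.prof (classifier c)).obj a).obj (op l))
    (z : ((SmallProfunctor.prof (((limitCone F W).app j).obj x)).obj l).obj b) :
    (pair l m z : ((SmallProfunctor.prof
        (classifier c ≫ ((limitCone F W).app j).obj x : A ⟶ F.obj j)).obj a).obj b) =
      pair (H := classifier c) (G := ((limitCone F W).app j).obj x)
        (ShrinkHoms.toShrinkHoms ((evCone c).obj a)) (classifierId c a)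
          (((((classifierHom c m).app j).app x).hom.app pt).app b z) := by
  refine Eq.trans ?_ (pair_sound (H := classifier c) (G := ((limitCone F W).app j).obj x)
    (b := l) (b' := ShrinkHoms.toShrinkHoms ((evCone c).obj a)) m (classifierId c a) z)
  refine congrArg (fun t => pair (H := classifier c) (G := ((limitCone F W).app j).obj x) l t z) ?_
  exact (Category.comp_id (X := (l : ShrinkHoms (WCone W F point))) m).symm

theorem ap_counitHom_classifierId (c : WCone W F A) (j : J) (x : W.obj j) {a : A.cat}
    {b : (F.obj j).catᵒᵖ} (z : ((SmallProfunctor.prof ((c.app j).obj x)).obj a).obj b) :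
    Hom.ap (counitHom c j x) (pair (H := classifier c) (G := ((limitCone F W).app j).obj x)
      (ShrinkHoms.toShrinkHoms ((evCone c).obj a)) (classifierId c a) z) = z := by
  refine (ap_counitHom c (ShrinkHoms.toShrinkHoms ((evCone c).obj a)) (classifierId c a) z).trans ?_
  have h : classifierHom c (classifierId c a) = 𝟙 ((evCone c).obj a) :=
    (equivShrink _).symm_apply_apply _
  rw [h]
  rfl

/-- Every pair has a normal form at the generic element, whose second entry is its image under the
counit. So the image determines the pair, and every element is an image. -/
theorem isIso_counitHom (c : WCone W F A) (j : J) (x : W.obj j) : IsIso (counitHom c j x) := by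
  refine isIso_of_bijective _ fun a b => ⟨fun w w' h => ?_, fun z =>
    ⟨_, ap_counitHom_classifierId c j x z⟩⟩
  induction w using pair_ind with | w l m z
  induction w' using pair_ind with | w l' m' z'
  refine (pair_classifierId c j x l m z).trans (Eq.trans ?_ (pair_classifierId c j x l' m' z').symm)
  refine congrArg (pair (H := classifier c) (G := ((limitCone F W).app j).obj x)
    (ShrinkHoms.toShrinkHoms ((evCone c).obj a)) (classifierId c a)) ?_
  exact (ap_counitHom c l m z).symm.trans (Eq.trans h (ap_counitHom c l' m' z'))

/-- The counit. -/
noncomputable def counitIso (c : WCone W F A) :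
    ((limitCone F W).comparison A).obj (classifier c) ≅ c :=
  WCone.isoMk
    (fun j => NatIso.ofComponents
      (fun x => @asIso _ _ _ _ (counitHom c j x) (isIso_counitHom c j x)) (fun {x y} p => by
      refine hom_ext_pair fun {a b} l m z => ?_
      refine (congrArg (Hom.ap (counitHom c j y)) (ap_whiskerLeft (classifier c)
        (((limitCone F W).app j).map p) l m z)).trans ?_
      refine (ap_counitHom c l m _).trans ?_
      refine Eq.trans ?_ (congrArg (Hom.ap ((c.app j).map p)) (ap_counitHom c l m z)).symm
      exact congrArg (fun s => (NatTrans.app ((Hom.hom s).app pt) b) z)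
        (((classifierHom c m).app j).naturality p)))
    (fun {i j} f x => (comm_iff c f x (counitHom c i x) (counitHom c j _)).2 fun a l m => by
      rw [sect_counitHom, sect_counitHom]
      exact hom_comm_app (classifierHom c m) f x)

theorem ap_comparison_counitIso {H : A ⟶ limitVertex F W} (c : WCone W F A)
    (τ : H ⟶ classifier c) (j : J) (x : W.obj j) {a : A.cat} {b : (F.obj j).catᵒᵖ}
    (l : (limitVertex F W).cat) (h : ((SmallProfunctor.prof H).obj a).obj (op l))
    (z : ((SmallProfunctor.prof (((limitCone F W).app j).obj x)).obj l).obj b) :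
    Hom.ap ((((((limitCone F W).comparison A).map τ ≫ (counitIso c).hom).app j).app x))
      (pair l h z) = ((((classifierHom c (Hom.ap τ h)).app j).app x).hom.app pt).app b z := by
  refine Eq.trans ?_ (ap_counitHom c l (Hom.ap τ h) z)
  exact congrArg (Hom.ap (counitHom c j x)) (ap_whiskerRight τ _ l h z)

/-- The morphism of cones with vertex the terminal category given by an element of `H` and a
morphism of cones out of the comparison with `H`. -/
noncomputable def sectHom {H : A ⟶ limitVertex F W} {c : WCone W F A}
    (s : ((limitCone F W).comparison A).obj H ⟶ c) {a : A.cat} {l : (limitVertex F W).cat}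
    (h : ((SmallProfunctor.prof H).obj a).obj (op l)) :
    (toCone F W).obj l ⟶ (evCone c).obj a where
  app j :=
    { app := fun x => pointHom (sect ((s.app j).app x) h)
      naturality := fun x y p => pointHom_ext (by
        ext b z
        have e := congrArg (fun t => Hom.ap t (pair l h z)) ((s.app j).naturality p)
        refine Eq.trans ?_ e
        exact (congrArg (Hom.ap ((s.app j).app y))
          (ap_whiskerLeft H (((limitCone F W).app j).map p) l h z)).symm) }
  comm {i j} f x := pointHom_ext (by
    refine ((comm_iff c f x _ _).1 (s.comm f x) a l h).trans ?_
    exact congrArg (fun t => (((toCone F W).obj l).nat f x).hom.hom.app pt ≫ t)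
      (whiskerRight_app (pointHom (H := (((toCone F W).obj l).app i).obj x)
        (G := (((evCone c).obj a).app i).obj x) (sect ((s.app i).app x) h)) (F.map f) pt).symm)

/-- The transformation into the representable profunctor given by a morphism of cones. -/
noncomputable def classify {H : A ⟶ limitVertex F W} (c : WCone W F A)
    (s : ((limitCone F W).comparison A).obj H ⟶ c) : H ⟶ classifier c :=
  Hom.mk (H := H) (G := classifier c)
    { app := fun a =>
        { app := fun l => ↾(fun h => equivShrink _ (sectHom s h))
          naturality := fun l l' g => by
            ext h
            refine (classifierHom_bijective c).1 ?_
            refine Eq.trans ?_ (classifierHom_map c g.unop _).symm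
            refine ((equivShrink _).symm_apply_apply _).trans ?_
            refine Eq.trans ?_ (congrArg (fun t => (toCone F W).map g.unop ≫ t)
              ((equivShrink _).symm_apply_apply _)).symm
            ext j x
            refine pointHom_ext ?_
            ext b z
            -- Naturality in the object of the vertex is the coend relation, which moves `g` from
            -- `h` to `z`.
            exact congrArg (Hom.ap ((s.app j).app x)) (pair_sound (H := H)
              (G := ((limitCone F W).app j).obj x) g.unop h z) }
      naturality := fun a a' φ => by
        ext l h
        refine (classifierHom_bijective c).1 ?_
        refine Eq.trans ?_ (classifierHom_app c φ _).symm
        refine ((equivShrink _).symm_apply_apply _).trans ?_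
        refine Eq.trans ?_ (congrArg (fun t => t ≫ (evCone c).map φ)
          ((equivShrink _).symm_apply_apply _)).symm
        ext j x
        refine pointHom_ext ?_
        ext b z
        refine (congrArg (Hom.ap ((s.app j).app x)) (map_app_pair (H := H)
          (G := ((limitCone F W).app j).obj x) φ l.unop h z).symm).trans ?_
        exact ap_app ((s.app j).app x) φ _ }

theorem classifierHom_classify {H : A ⟶ limitVertex F W} (c : WCone W F A)
    (s : ((limitCone F W).comparison A).obj H ⟶ c) {a : A.cat}
    (l : (limitVertex F W).cat) (h : ((SmallProfunctor.prof H).obj a).obj (op l)) :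
    classifierHom c (Hom.ap (classify c s) h) = sectHom s h :=
  (equivShrink _).symm_apply_apply _

/-- An element `h` of `H` together with `s` gives the cone morphism `z ↦ s (h, z)`, that is, an
element of the classifier. Hence `s` and a transformation into the classifier carry the same data,
and `ap_comparison_counitIso` shows that the comparison followed by the counit realises this
correspondence. -/
theorem isReflectorLimit_limitCone : (limitCone F W).IsReflectorLimit := fun A =>
  isReflector_of_universal _ fun c => by
    refine ⟨classifier c, counitIso c, fun H => ⟨fun τ τ' e => ?_, fun s => ?_⟩⟩
    · refine SmallProfunctor.hom_ext fun a l h => (classifierHom_bijective c).1 ?_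
      ext j x
      refine pointHom_ext ?_
      ext b z
      refine (ap_comparison_counitIso c τ j x l.unop h z).symm.trans ?_
      refine Eq.trans ?_ (ap_comparison_counitIso c τ' j x l.unop h z)
      exact congrArg (fun t => Hom.ap ((WCone.Hom.app t j).app x) (pair l.unop h z)) e
    · refine ⟨classify c s, ?_⟩
      ext j x
      refine hom_ext_pair fun {a b} l h z => ?_
      refine (ap_comparison_counitIso c _ j x l h z).trans ?_
      rw [classifierHom_classify]
      rfl

end Prof

end ReflLimit

theorem mainTheorem6 :
    (∀ (K : Type u₁) [Bicategory.{w₁, v₁} K] [Strict K]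
        (J : Type u₂) [Bicategory.{w₂, v₂} J] [Strict J] (D : ReflLimit.LeftKanPseudomonad K),
        ReflLimit.HasWeightedBilimits.{w₁, v₁, u₁, w₂, v₂, u₂, v₃, u₃} J K →
        ReflLimit.HasWeightedReflectorLimits.{w₁, v₁, u₁, w₂, v₂, u₂, v₃, u₃} J
          (ReflLimit.Kleisli D)) ∧
    (∀ (J : Type u) [Bicategory.{u, u} J] (F : J ⥤ᵖ ReflLimit.Prof.{u}) (W : J ⥤ᵖ Cat.{u, u}),
        ∃ (L : ReflLimit.Prof.{u}) (c : ReflLimit.WCone W F L), c.IsReflectorLimit) := by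
  exact ⟨fun K _ _ J _ _ D H => ReflLimit.Kleisli.hasWeightedReflectorLimits K J D H,
    fun J _ F W => ⟨_, _, ReflLimit.Prof.isReflectorLimit_limitCone (F := F) (W := W)⟩⟩
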